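/- Let $A$ and $B$ be skew shapes (each is the set of boxes $\lambda/\mu$ of a Young diagram $\lambda$ with a Young diagram $\mu\subseteq\lambda$ removed). Let $s_A=\sum_T x^T$ be the skew Schur function of $A$, the sum over all semistandard Young tableaux of shape $A$. The Schur support of $A$ is the set of partitions $\nu$ such that $s_\nu$ has nonzero coefficient in the expansion of $s_A$ as a linear combination of Schur functions. The $F$-support of $A$ is the set of compositions $\alpha$ such that $F_\alpha$ has positive coefficient in the expansion of $s_A$ in the basis of fundamental quasisymmetric functions $$F_\alpha=\sum_{S(\alpha)\subseteq S(\beta),\ |\beta|=|\alpha|}M_\beta,\qquad M_\beta=\sum_{i_1<\cdots<i_m}x_{i_1}^{\beta_1}\cdots x_{i_m}^{\beta_m},\qquad S(\alpha)=\{\alpha_1,\ \alpha_1+\alpha_2,\ \ldots,\ \alpha_1+\cdots+\alpha_{p-1}\},$$ where $\alpha=(\alpha_1,\ldots,\alpha_p)$ and $\beta=(\beta_1,\ldots,\beta_m)$ are compositions. For $k\ge 1$, let $\mathrm{rows}_k(A)$ be the partition obtained by taking, for every $k$ consecutive rows of $A$, the number of columns that these rows occupy in common, and sorting these numbers into weakly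 decreasing order (zeros omitted). Let $\mathrm{cols}_\ell(A)$, $\ell\ge1$, be the partition defined in the same way with rows and columns exchanged, and let $\mathrm{rects}_{k,\ell}(A)$ be the number of $k\times\ell$ rectangular subdiagrams (with $k$ consecutive rows and $\ell$ consecutive columns) contained in $A$. If $s_A=s_B$, or $A$ and $B$ have equal Schur supports, or $A$ and $B$ have equal $F$-supports, then - $\mathrm{rows}_k(A)=\mathrm{rows}_k(B)$ for all $k\ge1$; - $\mathrm{cols}_\ell(A)=\mathrm{cols}_\ell(B)$ for all $\ell\ge1$; - $\mathrm{rects}_{k,\ell}(A)=\mathrm{rects}_{k,\ell}(B)$ for all $k,\ell\ge1$. -/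

import Mathlib

/-- A skew shape `outer / inner`, given by two Young diagrams with `inner ⊆ outer`.  Cells are
pairs `(row, column)` in English notation, both indices starting at `0`. -/
structure SkewShape where
  outer : YoungDiagram
  inner : YoungDiagram
  inner_le_outer : inner ≤ outer

/-- The straight shape `ν / ∅`. -/
def SkewShape.straight (ν : YoungDiagram) : SkewShape := ⟨ν, ⊥, bot_le⟩

namespace SkewShape

/-- The boxes of a skew shape. -/
def cells (A : SkewShape) : Finset (ℕ × ℕ) := A.outer.cells \ A.inner.cells

/-- The number of columns occupied in common by the `k` consecutive rows `i, …, i + k - 1`. -/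
def rowOverlap (A : SkewShape) (k i : ℕ) : ℕ :=
  {j ∈ A.cells.image Prod.snd | ∀ a < k, (i + a, j) ∈ A.cells}.card

/-- The number of rows occupied in common by the `k` consecutive columns `j, …, j + k - 1`. -/
def colOverlap (A : SkewShape) (k j : ℕ) : ℕ :=
  {i ∈ A.cells.image Prod.fst | ∀ b < k, (i, j + b) ∈ A.cells}.card

/-- The partition `rows_k(A)`, for `k ≥ 1`: the row overlaps of `k` consecutive rows, sorted into
weakly decreasing order.  As for any partition, zero entries are not recorded. -/
def rowsk (A : SkewShape) (k : ℕ) : List ℕ :=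
  (((Multiset.range (A.outer.colLen 0 + 1 - k)).map (A.rowOverlap k)).filter (0 < ·)).sort
    (· ≥ ·)

/-- The partition `cols_k(A)`, for `k ≥ 1`: the column overlaps of `k` consecutive columns, sorted
into weakly decreasing order.  As for any partition, zero entries are not recorded. -/
def colsk (A : SkewShape) (k : ℕ) : List ℕ :=
  (((Multiset.range (A.outer.rowLen 0 + 1 - k)).map (A.colOverlap k)).filter (0 < ·)).sort
    (· ≥ ·)

/-- The number of `k × l` rectangular subdiagrams contained in `A`, for `k, l ≥ 1`; they are counted
by their top left box. -/
def rects (A : SkewShape) (k l : ℕ) : ℕ :=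
  {c ∈ A.cells | ∀ a < k, ∀ b < l, (c.1 + a, c.2 + b) ∈ A.cells}.card

/-- Semistandard Young tableaux of skew shape `A`: entries increase weakly along rows and strictly
down columns. -/
structure SSYT (A : SkewShape) where
  entry : A.cells → ℕ
  row_weak : ∀ c d : A.cells, c.1.1 = d.1.1 → c.1.2 < d.1.2 → entry c ≤ entry d
  col_strict : ∀ c d : A.cells, c.1.2 = d.1.2 → c.1.1 < d.1.1 → entry c < entry d

/-- The exponent vector of the monomial `x^T = ∏ x_{T(c)}`, the product over all boxes `c`. -/
noncomputable def SSYT.content {A : SkewShape} (T : A.SSYT) : ℕ →₀ ℕ :=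
  ∑ c, Finsupp.single (T.entry c) 1

end SkewShape

/-- The formal power series `∑ i, x^(e i)` in the variables `x_0, x_1, …`, for a family of exponent
vectors in which each vector occurs only finitely often: the coefficient of `x^d` is the number of
indices `i` with `e i = d`. -/
noncomputable def monomialSum {ι : Type} (e : ι → (ℕ →₀ ℕ)) : MvPowerSeries ℕ ℚ :=
  fun d => (Nat.card {i // e i = d} : ℚ)

/-- The skew Schur function `s_A = ∑ x^T`, the sum over all semistandard tableaux `T` of shape
`A`. -/
noncomputable def skewSchur (A : SkewShape) : MvPowerSeries ℕ ℚ :=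
  monomialSum (SkewShape.SSYT.content (A := A))

/-- The Schur function `s_ν` of a partition `ν`, given by its Young diagram. -/
noncomputable def schur (ν : YoungDiagram) : MvPowerSeries ℕ ℚ :=
  skewSchur (SkewShape.straight ν)

/-- The set `S(α) = {α₁, α₁ + α₂, …, α₁ + ⋯ + α_{k-1}}` of a composition `α = (α₁, …, α_k)`. -/
def Composition.partialSums {n : ℕ} (α : Composition n) : Finset ℕ :=
  (Finset.Ico 1 α.length).image α.sizeUpTo

/-- The monomial quasisymmetric function
`M_α = ∑ x_{i₁}^{α₁} ⋯ x_{i_k}^{α_k}`, the sum over `i₁ < ⋯ < i_k`. -/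
noncomputable def monomialQSym {n : ℕ} (α : Composition n) : MvPowerSeries ℕ ℚ :=
  monomialSum fun i : Fin α.length ↪o ℕ => ∑ j, Finsupp.single (i j) (α.blocksFun j)

/-- The fundamental quasisymmetric function `F_α`, the sum of all `M_β` with `|β| = |α|` and
`S(α) ⊆ S(β)`.  The index is a composition together with its size. -/
noncomputable def fundamentalQSym (α : Σ n, Composition n) : MvPowerSeries ℕ ℚ :=
  ∑ β : Composition α.1 with α.2.partialSums ⊆ β.partialSums, monomialQSym β

/-- The Schur support of `A`: the partitions `ν` such that `s_ν` has nonzero coefficient in the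
expansion of `s_A` as a linear combination of Schur functions. -/
def schurSupport (A : SkewShape) : Set YoungDiagram :=
  {ν | ∃ c : YoungDiagram →₀ ℚ, Finsupp.linearCombination ℚ schur c = skewSchur A ∧ c ν ≠ 0}

/-- The `F`-support of `A`: the compositions `α` such that `F_α` has positive coefficient in the
expansion of `s_A` as a linear combination of fundamental quasisymmetric functions. -/
def fundamentalSupport (A : SkewShape) : Set (Σ n, Composition n) :=
  {α | ∃ c : (Σ n, Composition n) →₀ ℚ,
    Finsupp.linearCombination ℚ fundamentalQSym c = skewSchur A ∧ 0 < c α}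

/-! Everything reduces to the rectangle counts. If `k` consecutive rows share `x` columns, they
contain `(x + 1 - l)₊` rectangles of width `l`, so the second differences in `l` of the counts
recover the multiset of positive overlaps; columns follow by transposition.

Let `A.shrink` be `A` without the last box of each column. A `(k + 1) × l` rectangle in `A` is a `k
× l` rectangle in `A.shrink` with the same corner, and transposition gives the same reduction for
`l`. All counts thus reduce to the number of boxes, and any relation that preserves size and is
stable under `shrink` and `transpose` preserves every `rects k l` (`rects_eq_of_relation`). It
remains to see that equality of supports is such a relation.

Stability under `shrink`: a tableau has at most one `0` per column, and those with a `0` in every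
column are obtained from tableaux of shape `A.shrink`. Hence the coefficient of the top power of
`x_0` in `s_A` is `s_{A.shrink}` (`headCoeff_skewSchur`). For a straight shape this removes the
first row, so the Schur support of `A.shrink` consists of the tails of those `ν` in the support of
`A` whose first row is longest. This uses that Schur functions are linearly independent and span the
symmetric series of bounded degree; skew Schur functions are symmetric by the Bender–Knuth
involution. In the `F`-basis, each coefficient of `s_{A.shrink}` is a sum of coefficients of `s_A`.
These are nonnegative, so positivity passes from one support to the other.

Stability under `transpose`: standardization shows that the coefficient of `F_α` in `s_A` counts
standard tableaux with descent set `S(α)`. Transposing a standard tableau complements its descent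
set. This settles the `F`-support and, applied to both sides of a Schur expansion, shows that
transposing `A` transposes every `ν` in its Schur support. Equality of skew Schur functions is a
special case of equality of `F`-supports. -/

/-! ### Multisets and their truncated sums. -/

/-- The second difference of `l ↦ (x + 1 - l)₊` is the indicator of `l = x`; summing over `s` gives
the multiplicity of `l`. -/
theorem Multiset.sum_map_add_one_sub (s : Multiset ℕ) (l : ℕ) :
    (s.map (· + 1 - l)).sum + (s.map (· + 1 - (l + 2))).sum =
      2 * (s.map (· + 1 - (l + 1))).sum + s.count l := by
  induction s using Multiset.induction with
  | empty => simp
  | cons a s ih =>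
    simp only [Multiset.map_cons, Multiset.sum_cons, Multiset.count_cons]
    split_ifs <;> omega

/-- The positive entries of a multiset of natural numbers are determined by the sums of the
truncations `(x + 1 - l)₊`. -/
theorem Multiset.filter_pos_eq_of_sum_map_add_one_sub_eq {s t : Multiset ℕ}
    (h : ∀ l, 1 ≤ l → (s.map (· + 1 - l)).sum = (t.map (· + 1 - l)).sum) :
    s.filter (0 < ·) = t.filter (0 < ·) := by
  ext l
  rw [Multiset.count_filter, Multiset.count_filter]
  split_ifs with hl
  · have hs := s.sum_map_add_one_sub l
    have ht := t.sum_map_add_one_sub l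
    have h0 := h l hl
    have h1 := h (l + 1) (by omega)
    have h2 := h (l + 2) (by omega)
    omega
  · rfl

/-! ### Transposition, removal of column ends, and rectangle counts. -/

namespace YoungDiagram

/-- The Young diagram with the first row removed. -/
def tailRows (ν : YoungDiagram) : YoungDiagram where
  cells := (ν.cells.filter fun c => 1 ≤ c.1).image fun c => (c.1 - 1, c.2)
  isLowerSet := by
    intro c d hdc hc
    simp only [Finset.coe_image, Set.mem_image, Finset.mem_coe, Finset.mem_filter] at hc ⊢
    obtain ⟨e, ⟨he, he1⟩, rfl⟩ := hc
    obtain ⟨h1, h2⟩ := hdc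
    refine ⟨(d.1 + 1, d.2), ⟨ν.up_left_mem (i2 := e.1) (j2 := e.2) ?_ h2 he, by simp⟩, by simp⟩
    simp only at h1
    omega

theorem mem_tailRows {ν : YoungDiagram} {i j : ℕ} : (i, j) ∈ ν.tailRows ↔ (i + 1, j) ∈ ν := by
  rw [← mem_cells, ← mem_cells]
  simp only [tailRows, Finset.mem_image, Finset.mem_filter, Prod.mk.injEq]
  constructor
  · rintro ⟨⟨a, b⟩, ⟨h, h1⟩, h2, rfl⟩
    simp only at h1 h2
    have : a = i + 1 := by omega
    subst this
    exact h
  · intro h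
    exact ⟨(i + 1, j), ⟨h, by simp⟩, by simp, rfl⟩

theorem bot_transpose : (⊥ : YoungDiagram).transpose = ⊥ := by
  ext; simp

end YoungDiagram

namespace SkewShape

variable (A : SkewShape)

theorem mem_cells_iff {A : SkewShape} {c : ℕ × ℕ} : c ∈ A.cells ↔ c ∈ A.outer ∧ c ∉ A.inner := by
  simp [cells]

theorem mem_cells_iff_rowLen {A : SkewShape} {i j : ℕ} :
    (i, j) ∈ A.cells ↔ A.inner.rowLen i ≤ j ∧ j < A.outer.rowLen i := by
  rw [mem_cells_iff, YoungDiagram.mem_iff_lt_rowLen, YoungDiagram.mem_iff_lt_rowLen]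
  omega

theorem mem_cells_of_between {A : SkewShape} {c d e : ℕ × ℕ} (hc : c ∈ A.cells) (he : e ∈ A.cells)
    (hcd : c ≤ d) (hde : d ≤ e) : d ∈ A.cells := by
  rw [mem_cells_iff] at *
  exact ⟨A.outer.isLowerSet hde he.1, fun h => hc.2 (A.inner.isLowerSet hcd h)⟩

/-- The skew shape with rows and columns exchanged. -/
def transpose : SkewShape :=
  ⟨A.outer.transpose, A.inner.transpose, YoungDiagram.transpose_mono A.inner_le_outer⟩

theorem mem_transpose_cells {A : SkewShape} {c : ℕ × ℕ} :
    c ∈ A.transpose.cells ↔ c.swap ∈ A.cells := by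
  simp [mem_cells_iff, transpose]

theorem straight_transpose (ν : YoungDiagram) :
    (straight ν).transpose = straight ν.transpose := by
  simp [transpose, straight, YoungDiagram.bot_transpose]

theorem card_transpose_cells : A.transpose.cells.card = A.cells.card := by
  refine Finset.card_nbij' Prod.swap Prod.swap ?_ ?_ ?_ ?_ <;> intro c hc <;>
    simp_all [mem_transpose_cells]

/-- The skew shape obtained by removing the last box of every nonempty column. -/
def shrink : SkewShape := ⟨A.inner ⊔ A.outer.tailRows, A.inner, le_sup_left⟩

/-- A box survives exactly when the box below it is also present. Taking the join with `inner` in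
`shrink` only restores the containment of `inner`; it adds no boxes. -/
theorem mem_shrink_cells {A : SkewShape} {i j : ℕ} :
    (i, j) ∈ A.shrink.cells ↔ (i, j) ∈ A.cells ∧ (i + 1, j) ∈ A.cells := by
  simp only [mem_cells_iff, shrink, YoungDiagram.mem_sup, YoungDiagram.mem_tailRows]
  have h1 : (i + 1, j) ∈ A.outer → (i, j) ∈ A.outer := A.outer.up_left_mem (by simp) le_rfl
  have h2 : (i + 1, j) ∈ A.inner → (i, j) ∈ A.inner := A.inner.up_left_mem (by simp) le_rfl
  tauto

theorem straight_shrink (ν : YoungDiagram) : (straight ν).shrink = straight ν.tailRows := by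
  simp [shrink, straight]

theorem rects_one_one : A.rects 1 1 = A.cells.card := by
  simp [rects]

/-- The same corners are counted: the bottom row of the taller rectangle consists of the boxes below
the bottom row of the shorter one. -/
theorem rects_succ {k l : ℕ} (hk : 1 ≤ k) (hl : 1 ≤ l) :
    A.rects (k + 1) l = A.shrink.rects k l := by
  unfold rects
  congr 1
  ext ⟨i, j⟩
  simp only [Finset.mem_filter, mem_shrink_cells]
  constructor
  · rintro ⟨h, h'⟩
    refine ⟨⟨h, h' 1 (by omega) 0 (by omega)⟩, fun a ha b hb => ⟨h' a (by omega) b hb, ?_⟩⟩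
    rw [add_assoc]
    exact h' (a + 1) (by omega) b hb
  · rintro ⟨h, h'⟩
    refine ⟨h.1, fun a ha b hb => ?_⟩
    rcases Nat.lt_or_ge a k with h1 | h1
    · exact (h' a h1 b hb).1
    · have := (h' (a - 1) (by omega) b hb).2
      rwa [show i + (a - 1) + 1 = i + a by omega] at this

theorem rects_transpose (k l : ℕ) : A.transpose.rects k l = A.rects l k := by
  unfold rects
  refine Finset.card_nbij' Prod.swap Prod.swap ?_ ?_ ?_ ?_
  · rintro ⟨i, j⟩ h
    simp only [Finset.coe_filter, Set.mem_ofPred_eq, mem_transpose_cells, Prod.swap] at h ⊢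
    exact ⟨h.1, fun a ha b hb => h.2 b hb a ha⟩
  · rintro ⟨i, j⟩ h
    simp only [Finset.coe_filter, Set.mem_ofPred_eq, mem_transpose_cells, Prod.swap] at h ⊢
    exact ⟨h.1, fun a ha b hb => h.2 b hb a ha⟩
  · intro c _; simp
  · intro c _; simp

/-- Row lengths decrease downwards, so the top row imposes the strictest left bound and the bottom
row the strictest right bound. The common columns form an interval. -/
theorem forall_mem_cells_iff {A : SkewShape} {k i j : ℕ} (hk : 1 ≤ k) :
    (∀ a < k, (i + a, j) ∈ A.cells) ↔ A.inner.rowLen i ≤ j ∧ j < A.outer.rowLen (i + (k - 1)) := by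
  simp only [mem_cells_iff_rowLen]
  constructor
  · intro h
    exact ⟨(h 0 (by omega)).1, (h (k - 1) (by omega)).2⟩
  · rintro ⟨h1, h2⟩ a ha
    exact ⟨(A.inner.rowLen_anti i (i + a) (by omega)).trans h1,
      h2.trans_le (A.outer.rowLen_anti _ _ (by omega))⟩

theorem rowOverlap_eq {k : ℕ} (hk : 1 ≤ k) (i : ℕ) :
    A.rowOverlap k i = A.outer.rowLen (i + (k - 1)) - A.inner.rowLen i := by
  rw [rowOverlap, ← Nat.card_Ico]
  congr 1
  ext j
  simp only [Finset.mem_filter, forall_mem_cells_iff hk, Finset.mem_Ico, and_iff_right_iff_imp,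
    Finset.mem_image]
  intro h
  rw [← forall_mem_cells_iff hk] at h
  exact ⟨(i, j), h 0 (by omega), rfl⟩

/-- Rectangles are grouped by their top row: an interval of `x` common columns has `x + 1 - l`
places for `l` consecutive columns. -/
theorem rects_eq_sum {k l : ℕ} (hk : 1 ≤ k) (hl : 1 ≤ l) :
    A.rects k l = (((Multiset.range (A.outer.colLen 0 + 1 - k)).map (A.rowOverlap k)).map
      (· + 1 - l)).sum := by
  rw [Multiset.map_map]
  change _ = ∑ i ∈ Finset.range (A.outer.colLen 0 + 1 - k), (A.rowOverlap k i + 1 - l)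
  have key : ∀ i j, ((i, j) ∈ A.cells ∧ ∀ a < k, ∀ b < l, (i + a, j + b) ∈ A.cells) ↔
      A.inner.rowLen i ≤ j ∧ j + l ≤ A.outer.rowLen (i + (k - 1)) := by
    intro i j
    constructor
    · rintro ⟨-, h⟩
      have h1 := (forall_mem_cells_iff hk).1 fun a ha => h a ha 0 (by omega)
      have h2 := (forall_mem_cells_iff hk).1 fun a ha => h a ha (l - 1) (by omega)
      omega
    · rintro ⟨h1, h2⟩
      have h3 : ∀ a < k, ∀ b < l, (i + a, j + b) ∈ A.cells := fun a ha b hb =>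
        (forall_mem_cells_iff hk).2 ⟨by omega, by omega⟩ a ha
      exact ⟨h3 0 (by omega) 0 (by omega), h3⟩
  unfold rects
  rw [Finset.card_eq_sum_card_fiberwise (f := Prod.fst)
    (t := Finset.range (A.outer.colLen 0 + 1 - k))]
  · refine Finset.sum_congr rfl fun i _ => ?_
    rw [A.rowOverlap_eq hk]
    trans (Finset.Ico (A.inner.rowLen i) (A.outer.rowLen (i + (k - 1)) + 1 - l)).card
    · refine Finset.card_nbij' Prod.snd (fun j => (i, j)) ?_ ?_ ?_ ?_
      · rintro ⟨i', j⟩ h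
        simp only [Finset.coe_filter, Set.mem_ofPred_eq, Finset.mem_filter] at h
        obtain ⟨h, rfl⟩ := h
        have := (key _ _).1 h
        simp only [Finset.coe_Ico, Set.mem_Ico]
        omega
      · intro j h
        simp only [Finset.coe_Ico, Set.mem_Ico] at h
        simp only [Finset.coe_filter, Set.mem_ofPred_eq, Finset.mem_filter, and_true]
        exact (key _ _).2 (by omega)
      · rintro ⟨i', j⟩ h
        simp only [Finset.coe_filter, Set.mem_ofPred_eq] at h
        simp [h.2]
      · intro j h; rfl
    · rw [Nat.card_Ico]; omega
  · rintro ⟨i, j⟩ h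
    simp only [Finset.coe_filter, Set.mem_ofPred_eq] at h
    have h1 := h.2 (k - 1) (by omega) 0 (by omega)
    have h2 := A.outer.up_left_mem le_rfl (Nat.zero_le _) (mem_cells_iff.1 h1).1
    rw [YoungDiagram.mem_iff_lt_colLen] at h2
    simp only [Finset.coe_range, Set.mem_Iio]
    omega

theorem rowsk_eq_of_rects_eq {A B : SkewShape} {k : ℕ} (hk : 1 ≤ k)
    (h : ∀ l, 1 ≤ l → A.rects k l = B.rects k l) : A.rowsk k = B.rowsk k := by
  unfold rowsk
  rw [Multiset.filter_pos_eq_of_sum_map_add_one_sub_eq]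
  intro l hl
  rw [← rects_eq_sum A hk hl, ← rects_eq_sum B hk hl, h l hl]

theorem rowOverlap_transpose (k i : ℕ) : A.transpose.rowOverlap k i = A.colOverlap k i := by
  unfold rowOverlap colOverlap
  congr 1
  ext j
  simp [mem_transpose_cells, Finset.mem_image]

theorem colsk_eq_rowsk_transpose (k : ℕ) : A.colsk k = A.transpose.rowsk k := by
  unfold colsk rowsk
  rw [show A.transpose.rowOverlap k = A.colOverlap k from funext (A.rowOverlap_transpose k)]
  simp [transpose]

theorem colsk_eq_of_rects_eq {A B : SkewShape} {l : ℕ} (hl : 1 ≤ l)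
    (h : ∀ k, 1 ≤ k → A.rects k l = B.rects k l) : A.colsk l = B.colsk l := by
  rw [colsk_eq_rowsk_transpose, colsk_eq_rowsk_transpose]
  refine rowsk_eq_of_rects_eq hl fun k hk => ?_
  rw [rects_transpose, rects_transpose, h k hk]

/-- A relation between skew shapes that preserves the size and is stable under transposition and
under removal of the last boxes of the columns preserves all rectangle counts. -/
theorem rects_eq_of_relation {R : SkewShape → SkewShape → Prop}
    (hcard : ∀ A B, R A B → A.cells.card = B.cells.card)
    (htrans : ∀ A B, R A B → R A.transpose B.transpose)
    (hshrink : ∀ A B, R A B → R A.shrink B.shrink) {A B : SkewShape} (h : R A B) {k l : ℕ}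
    (hk : 1 ≤ k) (hl : 1 ≤ l) : A.rects k l = B.rects k l := by
  -- Widths are lowered by conjugating `shrink` with `transpose`, heights afterwards by `shrink`
  -- itself.
  have hone : ∀ l, 1 ≤ l → ∀ A B, R A B → A.rects 1 l = B.rects 1 l := by
    intro l hl
    induction l, hl using Nat.le_induction with
    | base =>
      intro A B h
      rw [rects_one_one, rects_one_one, hcard A B h]
    | succ l hl ih =>
      intro A B h
      rw [← rects_transpose A, ← rects_transpose B, rects_succ _ hl le_rfl,
        rects_succ _ hl le_rfl, ← rects_transpose A.transpose.shrink,
        ← rects_transpose B.transpose.shrink]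
      exact ih _ _ (htrans _ _ (hshrink _ _ (htrans _ _ h)))
  induction k, hk using Nat.le_induction generalizing A B with
  | base => exact hone l hl A B h
  | succ k hk ih =>
    rw [rects_succ _ hk hl, rects_succ _ hk hl]
    exact ih (hshrink _ _ h)

end SkewShape

/-! ### Tableaux with a zero in every column, and the top coefficient in `x_0`. -/

/-- The exponent vector `(m, d₀, d₁, …)`. -/
noncomputable def Finsupp.natCons (m : ℕ) (d : ℕ →₀ ℕ) : ℕ →₀ ℕ :=
  Finsupp.single 0 m + d.mapDomain Nat.succ

@[simp]
theorem Finsupp.natCons_zero (m : ℕ) (d : ℕ →₀ ℕ) : Finsupp.natCons m d 0 = m := by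
  rw [natCons, Finsupp.add_apply, Finsupp.mapDomain_of_notMem_range]
  · simp
  · simp

@[simp]
theorem Finsupp.natCons_succ (m : ℕ) (d : ℕ →₀ ℕ) (t : ℕ) :
    Finsupp.natCons m d (t + 1) = d t := by
  rw [natCons, Finsupp.add_apply, Finsupp.mapDomain_apply Nat.succ_injective]
  simp

theorem Finsupp.natCons_degree (m : ℕ) (d : ℕ →₀ ℕ) :
    (Finsupp.natCons m d).degree = m + d.degree := by
  rw [natCons, map_add, Finsupp.degree_single, Finsupp.degree_mapDomain]

theorem Finsupp.exists_eq_natCons (d : ℕ →₀ ℕ) : ∃ d', d = Finsupp.natCons (d 0) d' := by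
  refine ⟨d.comapDomain Nat.succ Nat.succ_injective.injOn, ?_⟩
  ext t
  cases t <;> simp

theorem Finsupp.natCons_injective (m : ℕ) : Function.Injective (Finsupp.natCons m) := by
  intro d e h
  ext t
  simpa using DFunLike.congr_fun h (t + 1)

namespace SkewShape

variable {A : SkewShape}

namespace SSYT

@[ext]
theorem ext {T U : A.SSYT} (h : ∀ c, T.entry c = U.entry c) : T = U := by
  cases T; cases U
  congr
  exact funext h

theorem content_apply (T : A.SSYT) (t : ℕ) :
    T.content t = (Finset.univ.filter fun c => T.entry c = t).card := by
  rw [content, Finsupp.finsetSum_apply, Finset.card_filter]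
  exact Finset.sum_congr rfl fun c _ => by rw [Finsupp.single_apply]

theorem content_degree (T : A.SSYT) : T.content.degree = A.cells.card := by
  simp [content]

theorem entry_mem_support (T : A.SSYT) (c : A.cells) : T.entry c ∈ T.content.support := by
  rw [Finsupp.mem_support_iff, content_apply, ← Nat.pos_iff_ne_zero, Finset.card_pos]
  exact ⟨c, by simp⟩

/-- All entries lie in the support of `d`. Finiteness matters because `Nat.card` of an infinite type
is `0`, which would falsify the positivity of coefficients. -/
instance finite_content (d : ℕ →₀ ℕ) : Finite {T : A.SSYT // T.content = d} := by
  let f : {T : A.SSYT // T.content = d} → A.cells → d.support := fun T c =>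
    ⟨T.1.entry c, by
      have := T.1.entry_mem_support c
      rwa [T.2] at this⟩
  refine Finite.of_injective f fun T U h => Subtype.ext (ext fun c => ?_)
  exact congrArg Subtype.val (congrFun h c)

/-- By convexity the corner in the row of `c` and the column of `d` belongs to the shape; the path
from `c` to `d` turns there. -/
theorem entry_le_of_le (T : A.SSYT) {c d : A.cells} (h : c.1 ≤ d.1) : T.entry c ≤ T.entry d := by
  obtain ⟨⟨i, j⟩, hc⟩ := c
  obtain ⟨⟨i', j'⟩, hd⟩ := d
  obtain ⟨h1, h2⟩ := Prod.mk_le_mk.1 h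
  have he : (i, j') ∈ A.cells := mem_cells_of_between hc hd (by simp [h2]) (by simp [h1])
  trans T.entry ⟨_, he⟩
  · rcases h2.eq_or_lt with rfl | h2
    · rfl
    · exact T.row_weak ⟨_, hc⟩ ⟨_, he⟩ rfl h2
  · rcases h1.eq_or_lt with rfl | h1
    · rfl
    · exact (T.col_strict ⟨_, he⟩ ⟨_, hd⟩ rfl h1).le

theorem entry_lt_of_le (T : A.SSYT) {c d : A.cells} (h : c.1 ≤ d.1) (h' : c.1.1 < d.1.1) :
    T.entry c < T.entry d := by
  obtain ⟨⟨i, j⟩, hc⟩ := c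
  obtain ⟨⟨i', j'⟩, hd⟩ := d
  obtain ⟨h1, h2⟩ := Prod.mk_le_mk.1 h
  have he : (i, j') ∈ A.cells := mem_cells_of_between hc hd (by simp [h2]) (by simp [h1])
  exact (T.entry_le_of_le (c := ⟨_, hc⟩) (d := ⟨_, he⟩) (by simp [h2])).trans_lt
    (T.col_strict ⟨_, he⟩ ⟨_, hd⟩ rfl h')

theorem eq_of_entry_eq_of_col_eq (T : A.SSYT) {c d : A.cells} (h : T.entry c = T.entry d)
    (h' : c.1.2 = d.1.2) : c = d := by
  rcases lt_trichotomy c.1.1 d.1.1 with h1 | h1 | h1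
  · exact absurd h (T.col_strict c d h' h1).ne
  · exact Subtype.ext (Prod.ext h1 h')
  · exact absurd h (T.col_strict d c h'.symm h1).ne'

end SSYT

instance : Nonempty A.SSYT :=
  ⟨⟨fun c => c.1.1, fun _ _ h _ => h.le, fun _ _ _ h => h⟩⟩

/-- The number of nonempty columns. -/
def numCols (A : SkewShape) : ℕ := (A.cells.image Prod.snd).card

theorem numCols_straight (ν : YoungDiagram) : (straight ν).numCols = ν.rowLen 0 := by
  rw [numCols, ← Finset.card_range (ν.rowLen 0)]
  congr 1
  ext j
  simp only [Finset.mem_image, mem_cells_iff, straight, YoungDiagram.notMem_bot,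
    not_false_eq_true, and_true, Finset.mem_range, ← YoungDiagram.mem_iff_lt_rowLen]
  constructor
  · rintro ⟨⟨i, j⟩, h, rfl⟩
    exact ν.up_left_mem (Nat.zero_le _) le_rfl h
  · intro h
    exact ⟨_, h, rfl⟩

namespace SSYT

theorem image_col_zeros_subset (T : A.SSYT) :
    ((Finset.univ.filter fun c => T.entry c = 0).image fun c : A.cells => c.1.2) ⊆
      A.cells.image Prod.snd := by
  intro j
  simp only [Finset.mem_image]
  rintro ⟨c, -, rfl⟩
  exact ⟨c.1, c.2, rfl⟩

theorem card_image_col_zeros (T : A.SSYT) :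
    ((Finset.univ.filter fun c => T.entry c = 0).image fun c : A.cells => c.1.2).card =
      T.content 0 := by
  rw [content_apply, Finset.card_image_of_injOn]
  intro c hc d hd h
  simp only [Finset.coe_filter, Finset.mem_univ, true_and, Set.mem_ofPred_eq] at hc hd
  exact T.eq_of_entry_eq_of_col_eq (hc.trans hd.symm) h

/-- Columns are strict, so each of them has at most one zero. -/
theorem content_zero_le (T : A.SSYT) : T.content 0 ≤ A.numCols := by
  rw [← card_image_col_zeros]
  exact Finset.card_le_card T.image_col_zeros_subset

/-- If the number of zeros is as large as possible, then every column has a zero. -/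
theorem exists_zero_of_content_zero_eq {T : A.SSYT} (h : T.content 0 = A.numCols) (c : A.cells) :
    ∃ d : A.cells, d.1.2 = c.1.2 ∧ T.entry d = 0 := by
  have := Finset.eq_of_subset_of_card_le T.image_col_zeros_subset
    (by rw [card_image_col_zeros, h]; rfl)
  have hc : c.1.2 ∈ A.cells.image Prod.snd := Finset.mem_image_of_mem _ c.2
  rw [← this] at hc
  obtain ⟨d, hd, hdc⟩ := Finset.mem_image.1 hc
  exact ⟨d, hdc, by simpa using hd⟩

/-- From a tableau of shape `A.shrink`, the tableau of shape `A` whose columns start with `0`,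
followed by the entries of the columns of the given tableau, increased by one. -/
def grow (T : A.shrink.SSYT) : A.SSYT where
  entry c := if h : 1 ≤ c.1.1 ∧ (c.1.1 - 1, c.1.2) ∈ A.shrink.cells then T.entry ⟨_, h.2⟩ + 1 else 0
  row_weak := by
    rintro ⟨⟨i, j⟩, hc⟩ ⟨⟨i', j'⟩, hd⟩ h1 h2
    dsimp only at h1 h2 ⊢
    subst h1
    split_ifs with h h'
    · exact Nat.succ_le_succ (T.row_weak _ _ rfl h2)
    -- If the box above the left one is present, so is the box above the right one: it lies between
    -- that box and the right box.
    · obtain ⟨hi, hm⟩ := h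
      refine absurd ⟨hi, ?_⟩ h'
      obtain ⟨i, rfl⟩ : ∃ a, i = a + 1 := ⟨i - 1, by omega⟩
      simp only [Nat.add_sub_cancel] at hm ⊢
      rw [mem_shrink_cells] at hm ⊢
      exact ⟨mem_cells_of_between hm.1 hd (by simp [h2.le]) (by simp), hd⟩
    · exact Nat.zero_le _
    · exact le_rfl
  col_strict := by
    rintro ⟨⟨i, j⟩, hc⟩ ⟨⟨i', j'⟩, hd⟩ h1 h2
    dsimp only at h1 h2 ⊢
    subst h1
    have h' : 1 ≤ i' ∧ (i' - 1, j) ∈ A.shrink.cells := by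
      refine ⟨by omega, ?_⟩
      obtain ⟨i', rfl⟩ : ∃ a, i' = a + 1 := ⟨i' - 1, by omega⟩
      rw [Nat.add_sub_cancel, mem_shrink_cells]
      exact ⟨mem_cells_of_between hc hd (by simp; omega) (by simp), hd⟩
    rw [dif_pos h']
    split_ifs with h
    · exact Nat.succ_lt_succ (T.col_strict _ _ rfl (by simp only; omega))
    · exact Nat.succ_pos _

theorem grow_entry_succ (T : A.shrink.SSYT) {i j : ℕ} (h : (i, j) ∈ A.shrink.cells) :
    (grow T).entry ⟨(i + 1, j), (mem_shrink_cells.1 h).2⟩ = T.entry ⟨(i, j), h⟩ + 1 := by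
  simp [grow, h]

theorem grow_injective : Function.Injective (grow (A := A)) := by
  rintro T U h
  ext ⟨⟨i, j⟩, hc⟩
  have h1 := grow_entry_succ T hc
  rw [h, grow_entry_succ U hc] at h1
  omega

theorem grow_content_succ (T : A.shrink.SSYT) (t : ℕ) :
    (grow T).content (t + 1) = T.content t := by
  rw [content_apply, content_apply]
  symm
  refine Finset.card_bij (fun c _ => ⟨(c.1.1 + 1, c.1.2), (mem_shrink_cells.1 c.2).2⟩) ?_ ?_ ?_
  · rintro ⟨⟨i, j⟩, hc⟩ h
    simp only [Finset.mem_filter, Finset.mem_univ, true_and] at h ⊢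
    rw [grow_entry_succ T hc, h]
  · rintro ⟨⟨i, j⟩, hc⟩ - ⟨⟨i', j'⟩, hd⟩ - h
    simp only [Subtype.mk.injEq, Prod.mk.injEq] at h ⊢
    omega
  · rintro ⟨⟨i, j⟩, hc⟩ h
    simp only [Finset.mem_filter, Finset.mem_univ, true_and] at h
    simp only [grow] at h
    split_ifs at h with h'
    refine ⟨⟨_, h'.2⟩, ?_, ?_⟩
    · simp only [Finset.mem_filter, Finset.mem_univ, true_and]
      omega
    · simp only [Subtype.mk.injEq, Prod.mk.injEq, and_true]
      omega

/-- The top box of each column has no box above it and therefore receives `0`. -/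
theorem grow_content_zero (T : A.shrink.SSYT) : (grow T).content 0 = A.numCols := by
  rw [← card_image_col_zeros]
  unfold numCols
  congr 1
  refine (image_col_zeros_subset _).antisymm fun j hj => ?_
  have hex : ∃ i, (i, j) ∈ A.cells := by
    obtain ⟨⟨i, j⟩, h, rfl⟩ := Finset.mem_image.1 hj
    exact ⟨i, h⟩
  classical
  refine Finset.mem_image.2 ⟨⟨(Nat.find hex, j), Nat.find_spec hex⟩, ?_, rfl⟩
  simp only [Finset.mem_filter, Finset.mem_univ, true_and]
  simp only [grow]
  rw [dif_neg]
  rintro ⟨h1, h2⟩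
  exact Nat.find_min hex (by omega) (mem_shrink_cells.1 h2).1

theorem grow_content (T : A.shrink.SSYT) :
    (grow T).content = Finsupp.natCons A.numCols T.content := by
  ext t
  cases t with
  | zero => rw [grow_content_zero, Finsupp.natCons_zero]
  | succ t => rw [grow_content_succ, Finsupp.natCons_succ]

/-- The inverse of `grow`: delete the zeros heading the columns, move the other entries up one box
and lower them by one. -/
theorem exists_grow_eq {U : A.SSYT} (hU : U.content 0 = A.numCols) : ∃ T, grow T = U := by
  have hpos : ∀ c : A.shrink.cells, 1 ≤ U.entry ⟨(c.1.1 + 1, c.1.2), (mem_shrink_cells.1 c.2).2⟩ :=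
    fun c => (Nat.zero_le _).trans_lt
      (U.col_strict ⟨c.1, (mem_shrink_cells.1 c.2).1⟩ _ rfl (Nat.lt_succ_self _))
  refine ⟨⟨fun c => U.entry ⟨(c.1.1 + 1, c.1.2), (mem_shrink_cells.1 c.2).2⟩ - 1, ?_, ?_⟩, ?_⟩
  · intro c d h1 h2
    exact Nat.sub_le_sub_right (U.row_weak _ _ (by simp [h1]) h2) 1
  · intro c d h1 h2
    have := U.col_strict ⟨(c.1.1 + 1, c.1.2), (mem_shrink_cells.1 c.2).2⟩
      ⟨(d.1.1 + 1, d.1.2), (mem_shrink_cells.1 d.2).2⟩ h1 (by simp [h2])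
    have := hpos c
    omega
  · ext ⟨⟨i, j⟩, hc⟩
    simp only [grow]
    split_ifs with h
    · obtain ⟨i, rfl⟩ : ∃ a, i = a + 1 := ⟨i - 1, by omega⟩
      have := hpos ⟨_, h.2⟩
      simp only [Nat.add_sub_cancel] at this ⊢
      omega
    -- Here the box is the top of its column. The zero of the column cannot lie below it by
    -- strictness, nor above it, so it is this box.
    · obtain ⟨⟨⟨i', j'⟩, hd⟩, h1, h2⟩ := exists_zero_of_content_zero_eq hU ⟨(i, j), hc⟩
      simp only at h1
      subst h1
      rcases lt_trichotomy i i' with hlt | rfl | hlt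
      · exact absurd h2 (Nat.pos_iff_ne_zero.1
          ((Nat.zero_le _).trans_lt (U.col_strict ⟨_, hc⟩ ⟨_, hd⟩ rfl hlt)))
      · exact h2.symm
      · refine absurd ⟨by omega, ?_⟩ h
        obtain ⟨i, rfl⟩ : ∃ a, i = a + 1 := ⟨i - 1, by omega⟩
        rw [Nat.add_sub_cancel, mem_shrink_cells]
        exact ⟨mem_cells_of_between hd hc (by simp; omega) (by simp), hc⟩

end SSYT

end SkewShape

/-- The coefficient of `x_0 ^ m` in a power series, as a power series in the remaining variables,
renumbered to start with `x_0`. -/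
noncomputable def headCoeff (m : ℕ) : MvPowerSeries ℕ ℚ →ₗ[ℚ] MvPowerSeries ℕ ℚ where
  toFun f d := MvPowerSeries.coeff (Finsupp.natCons m d) f
  map_add' _ _ := rfl
  map_smul' _ _ := rfl

theorem coeff_headCoeff (m : ℕ) (f : MvPowerSeries ℕ ℚ) (d : ℕ →₀ ℕ) :
    MvPowerSeries.coeff d (headCoeff m f) = MvPowerSeries.coeff (Finsupp.natCons m d) f := rfl

theorem coeff_skewSchur (A : SkewShape) (d : ℕ →₀ ℕ) :
    MvPowerSeries.coeff d (skewSchur A) = (Nat.card {T : A.SSYT // T.content = d} : ℚ) := rfl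

theorem coeff_skewSchur_pos {A : SkewShape} (T : A.SSYT) :
    0 < MvPowerSeries.coeff T.content (skewSchur A) := by
  rw [coeff_skewSchur, Nat.cast_pos, Nat.card_pos_iff]
  exact ⟨⟨⟨T, rfl⟩⟩, inferInstance⟩

theorem coeff_skewSchur_eq_zero {A : SkewShape} {d : ℕ →₀ ℕ} (h : ∀ T : A.SSYT, T.content ≠ d) :
    MvPowerSeries.coeff d (skewSchur A) = 0 := by
  rw [coeff_skewSchur, Nat.cast_eq_zero, Nat.card_eq_zero]
  exact Or.inl ⟨fun T => h T.1 T.2⟩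

theorem coeff_skewSchur_eq_zero_of_degree_ne {A : SkewShape} {d : ℕ →₀ ℕ}
    (h : d.degree ≠ A.cells.card) : MvPowerSeries.coeff d (skewSchur A) = 0 :=
  coeff_skewSchur_eq_zero fun T hT => h (by rw [← hT, T.content_degree])

theorem coeff_skewSchur_eq_zero_of_numCols_lt {A : SkewShape} {d : ℕ →₀ ℕ}
    (h : A.numCols < d 0) : MvPowerSeries.coeff d (skewSchur A) = 0 :=
  coeff_skewSchur_eq_zero fun T hT => h.not_ge (by rw [← hT]; exact T.content_zero_le)

theorem skewSchur_ne_zero (A : SkewShape) : skewSchur A ≠ 0 := by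
  intro h
  obtain ⟨T⟩ := (inferInstance : Nonempty A.SSYT)
  have := coeff_skewSchur_pos T
  rw [h, map_zero] at this
  exact this.false

/-- This makes `shrink` visible on power series: `grow` is a bijection onto the tableaux with the
maximal number of zeros. -/
theorem headCoeff_skewSchur (A : SkewShape) :
    headCoeff A.numCols (skewSchur A) = skewSchur A.shrink := by
  ext d
  rw [coeff_headCoeff, coeff_skewSchur, coeff_skewSchur, Nat.cast_inj]
  symm
  refine Nat.card_eq_of_bijective
    (fun T => ⟨T.1.grow, by rw [SkewShape.SSYT.grow_content, T.2]⟩) ⟨fun T U h => ?_, fun U => ?_⟩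
  · exact Subtype.ext (SkewShape.SSYT.grow_injective (congrArg Subtype.val h))
  · obtain ⟨T, hT⟩ := SkewShape.SSYT.exists_grow_eq (U := U.1) (by rw [U.2, Finsupp.natCons_zero])
    refine ⟨⟨T, Finsupp.natCons_injective A.numCols ?_⟩, Subtype.ext hT⟩
    rw [← SkewShape.SSYT.grow_content, hT, U.2]

theorem headCoeff_skewSchur_of_lt {A : SkewShape} {m : ℕ} (h : A.numCols < m) :
    headCoeff m (skewSchur A) = 0 := by
  ext d
  rw [coeff_headCoeff, map_zero]
  exact coeff_skewSchur_eq_zero_of_numCols_lt (by rwa [Finsupp.natCons_zero])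

/-! ### Symmetry of skew Schur functions: the Bender–Knuth involution. -/

theorem Finset.eq_Ico_of_lower {S : Finset ℕ} {a : ℕ} (h1 : ∀ x ∈ S, a ≤ x)
    (h2 : ∀ x ∈ S, ∀ y, a ≤ y → y < x → y ∈ S) : S = Finset.Ico a (a + S.card) := by
  rcases S.eq_empty_or_nonempty with rfl | hS
  · simp
  · have h : S = Finset.Ico a (S.max' hS + 1) := by
      ext x
      rw [Finset.mem_Ico]
      refine ⟨fun hx => ⟨h1 x hx, Nat.lt_succ_of_le (S.le_max' x hx)⟩, fun hx => ?_⟩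
      rcases (Nat.le_of_lt_succ hx.2).eq_or_lt with h | h
      · rw [h]; exact S.max'_mem hS
      · exact h2 _ (S.max'_mem hS) _ hx.1 h
    have hc := congrArg Finset.card h
    rw [Nat.card_Ico] at hc
    have := h1 _ (S.max'_mem hS)
    rw [hc]
    rwa [show a + (S.max' hS + 1 - a) = S.max' hS + 1 by omega]

namespace SkewShape.SSYT

variable {A : SkewShape}

open Classical in
/-- The columns of the boxes of row `r` with entry less than `t`. -/
noncomputable def smallCols (T : A.SSYT) (t r : ℕ) : Finset ℕ :=
  (Finset.range (A.outer.rowLen r)).filter fun j => ∃ h : (r, j) ∈ A.cells, T.entry ⟨_, h⟩ < t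

theorem mem_smallCols {T : A.SSYT} {t r j : ℕ} :
    j ∈ T.smallCols t r ↔ ∃ h : (r, j) ∈ A.cells, T.entry ⟨_, h⟩ < t := by
  simp only [smallCols, Finset.mem_filter, Finset.mem_range, and_iff_right_iff_imp]
  rintro ⟨h, -⟩
  exact (mem_cells_iff_rowLen.1 h).2

/-- The column at which the entries of row `r` that are at least `t` start. -/
noncomputable def rowStart (T : A.SSYT) (t r : ℕ) : ℕ :=
  A.inner.rowLen r + (T.smallCols t r).card

theorem smallCols_eq (T : A.SSYT) (t r : ℕ) :
    T.smallCols t r = Finset.Ico (A.inner.rowLen r) (T.rowStart t r) := by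
  refine Finset.eq_Ico_of_lower (fun x hx => ?_) fun x hx y hy hyx => ?_
  · obtain ⟨h, -⟩ := mem_smallCols.1 hx
    exact (mem_cells_iff_rowLen.1 h).1
  · obtain ⟨h, ht⟩ := mem_smallCols.1 hx
    have hy' : (r, y) ∈ A.cells :=
      mem_cells_iff_rowLen.2 ⟨hy, hyx.trans (mem_cells_iff_rowLen.1 h).2⟩
    exact mem_smallCols.2 ⟨hy', (T.row_weak ⟨_, hy'⟩ ⟨_, h⟩ rfl hyx).trans_lt ht⟩

/-- Rows weakly increase, so the entries below `t` form an initial segment. The tableau is thereby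
encoded by the numbers `rowStart t r`, and its conditions become interlacing inequalities. -/
theorem entry_lt_iff (T : A.SSYT) (t : ℕ) {r j : ℕ} (h : (r, j) ∈ A.cells) :
    T.entry ⟨_, h⟩ < t ↔ j < T.rowStart t r := by
  have h1 : j ∈ T.smallCols t r ↔ T.entry ⟨_, h⟩ < t := by simp [mem_smallCols, h]
  rw [← h1, smallCols_eq, Finset.mem_Ico, and_iff_right (mem_cells_iff_rowLen.1 h).1]

theorem inner_le_rowStart (T : A.SSYT) (t r : ℕ) : A.inner.rowLen r ≤ T.rowStart t r :=
  Nat.le_add_right _ _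

theorem rowLen_inner_le_outer (A : SkewShape) (r : ℕ) : A.inner.rowLen r ≤ A.outer.rowLen r := by
  by_contra! h
  have h1 := YoungDiagram.mem_iff_lt_rowLen.2 h
  exact (YoungDiagram.mem_iff_lt_rowLen.1 (A.inner_le_outer h1)).false

theorem rowStart_le_outer (T : A.SSYT) (t r : ℕ) : T.rowStart t r ≤ A.outer.rowLen r := by
  by_contra! h
  have h1 : A.outer.rowLen r ∈ T.smallCols t r := by
    rw [smallCols_eq, Finset.mem_Ico]
    exact ⟨rowLen_inner_le_outer A r, h⟩
  obtain ⟨h2, -⟩ := mem_smallCols.1 h1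
  exact (mem_cells_iff_rowLen.1 h2).2.false

theorem rowStart_mono (T : A.SSYT) {t u : ℕ} (h : t ≤ u) (r : ℕ) :
    T.rowStart t r ≤ T.rowStart u r := by
  refine Nat.add_le_add_left (Finset.card_le_card fun j hj => ?_) _
  obtain ⟨h1, h2⟩ := mem_smallCols.1 hj
  exact mem_smallCols.2 ⟨h1, h2.trans_le h⟩

/-- Column strictness in terms of starts: an entry at most `t` forces an entry less than `t` above
it, if there is a box above. -/
theorem rowStart_succ_le (T : A.SSYT) (t r : ℕ) : T.rowStart (t + 1) (r + 1) ≤ T.rowStart t r := by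
  by_contra! h
  have h0 := T.inner_le_rowStart t r
  have h1 := A.inner.rowLen_anti r (r + 1) (Nat.le_succ r)
  have h2 : T.rowStart t r ∈ T.smallCols (t + 1) (r + 1) := by
    rw [smallCols_eq, Finset.mem_Ico]
    exact ⟨h1.trans h0, h⟩
  obtain ⟨h3, h4⟩ := mem_smallCols.1 h2
  have h5 : (r, T.rowStart t r) ∈ A.cells := mem_cells_iff_rowLen.2
    ⟨h0, (mem_cells_iff_rowLen.1 h3).2.trans_le (A.outer.rowLen_anti _ _ (Nat.le_succ r))⟩
  have h6 := T.col_strict ⟨_, h5⟩ ⟨_, h3⟩ rfl (Nat.lt_succ_self r)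
  exact (((T.entry_lt_iff t h5).1 (by omega)).false)

theorem rowStart_eq_of_forall {T : A.SSYT} {t r b : ℕ} (h1 : A.inner.rowLen r ≤ b)
    (h2 : b ≤ A.outer.rowLen r)
    (h : ∀ j (hj : (r, j) ∈ A.cells), T.entry ⟨_, hj⟩ < t ↔ j < b) : T.rowStart t r = b := by
  have h3 := T.inner_le_rowStart t r
  have h4 := T.rowStart_le_outer t r
  rcases lt_trichotomy (T.rowStart t r) b with hlt | heq | hlt
  · have hm := mem_cells_iff_rowLen.2 ⟨h3, hlt.trans_le h2⟩
    exact absurd (((T.entry_lt_iff t hm).1 ((h _ hm).2 hlt))) (lt_irrefl _)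
  · exact heq
  · have hm := mem_cells_iff_rowLen.2 ⟨h1, hlt.trans_le h4⟩
    exact absurd ((h _ hm).1 ((T.entry_lt_iff t hm).2 hlt)) (lt_irrefl _)

theorem content_eq_sum_rowStart (T : A.SSYT) (t : ℕ) :
    T.content t =
      ∑ r ∈ Finset.range (A.outer.colLen 0), (T.rowStart (t + 1) r - T.rowStart t r) := by
  rw [content_apply, Finset.card_eq_sum_card_fiberwise (f := fun c : A.cells => c.1.1)
    (t := Finset.range (A.outer.colLen 0))]
  · refine Finset.sum_congr rfl fun r _ => ?_
    rw [← Nat.card_Ico]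
    refine Finset.card_bij (fun c _ => c.1.2) ?_ ?_ ?_
    · rintro ⟨⟨i, j⟩, hc⟩ h
      simp only [Finset.mem_filter, Finset.mem_univ, true_and] at h
      obtain ⟨h, rfl⟩ := h
      rw [Finset.mem_Ico, ← T.entry_lt_iff _ hc, ← not_lt, ← T.entry_lt_iff _ hc]
      omega
    · rintro ⟨⟨i, j⟩, hc⟩ h ⟨⟨i', j'⟩, hd⟩ h' heq
      simp only [Finset.mem_filter, Finset.mem_univ, true_and] at h h' heq
      simp only [Subtype.mk.injEq, Prod.mk.injEq]
      exact ⟨h.2.trans h'.2.symm, heq⟩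
    · intro j hj
      rw [Finset.mem_Ico] at hj
      have hm : (r, j) ∈ A.cells := mem_cells_iff_rowLen.2
        ⟨(T.inner_le_rowStart t r).trans hj.1, hj.2.trans_le (T.rowStart_le_outer _ r)⟩
      refine ⟨⟨_, hm⟩, ?_, rfl⟩
      rw [← T.entry_lt_iff _ hm, ← not_lt, ← T.entry_lt_iff _ hm] at hj
      simp only [Finset.mem_filter, Finset.mem_univ, true_and, and_true]
      omega
  · rintro ⟨⟨i, j⟩, hc⟩ -
    simp only [Finset.coe_range, Set.mem_Iio]
    rw [← YoungDiagram.mem_iff_lt_colLen]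
    exact A.outer.up_left_mem le_rfl (Nat.zero_le _) (mem_cells_iff.1 hc).1

/-- The largest possible start of the entries `≥ i + 1` in row `r`, given the starts of the entries
`≥ i` and `≥ i + 2`. -/
noncomputable def maxStart (T : A.SSYT) (i : ℕ) : ℕ → ℕ
  | 0 => T.rowStart (i + 2) 0
  | r + 1 => min (T.rowStart (i + 2) (r + 1)) (T.rowStart i r)

/-- The smallest possible start of the entries `≥ i + 1` in row `r`, given the starts of the entries
`≥ i` and `≥ i + 2`. -/
noncomputable def minStart (T : A.SSYT) (i r : ℕ) : ℕ :=
  max (T.rowStart i r) (T.rowStart (i + 2) (r + 1))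

theorem rowStart_le_maxStart (T : A.SSYT) (i r : ℕ) : T.rowStart (i + 1) r ≤ T.maxStart i r := by
  cases r with
  | zero => exact T.rowStart_mono (by omega) 0
  | succ r => exact le_min (T.rowStart_mono (by omega) _) (T.rowStart_succ_le i r)

theorem minStart_le_rowStart (T : A.SSYT) (i r : ℕ) : T.minStart i r ≤ T.rowStart (i + 1) r :=
  max_le (T.rowStart_mono (by omega) _) (T.rowStart_succ_le (i + 1) r)

theorem maxStart_le (T : A.SSYT) (i r : ℕ) : T.maxStart i r ≤ T.rowStart (i + 2) r := by
  cases r with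
  | zero => exact le_rfl
  | succ r => exact min_le_left _ _

/-- The minimum of row `r` and the maximum of row `r + 1` are the `max` and the `min` of the same
two numbers, so they add up to the sum of those numbers. One boundary term is left on each side. -/
theorem sum_minStart_add_maxStart (T : A.SSYT) (i n : ℕ) :
    ∑ r ∈ Finset.range n, (T.minStart i r + T.maxStart i r) + T.maxStart i n =
      ∑ r ∈ Finset.range n, (T.rowStart i r + T.rowStart (i + 2) r) + T.rowStart (i + 2) n := by
  induction n with
  | zero => simp [maxStart]
  | succ n ih =>
    rw [Finset.sum_range_succ, Finset.sum_range_succ]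
    have : T.minStart i n + T.maxStart i (n + 1) =
        T.rowStart i n + T.rowStart (i + 2) (n + 1) := by
      rw [minStart, maxStart, min_comm, max_add_min]
    omega

/-- The start of the entries `≥ i + 1` in row `r` after the Bender–Knuth involution. -/
noncomputable def toggleStart (T : A.SSYT) (i r : ℕ) : ℕ :=
  T.minStart i r + T.maxStart i r - T.rowStart (i + 1) r

/-- The toggle reflects the middle start within the interval of its admissible values; the
subtraction in its definition does not truncate. -/
theorem toggleStart_add (T : A.SSYT) (i r : ℕ) :
    T.toggleStart i r + T.rowStart (i + 1) r = T.minStart i r + T.maxStart i r := by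
  have := T.rowStart_le_maxStart i r
  unfold toggleStart
  omega

theorem minStart_le_toggleStart (T : A.SSYT) (i r : ℕ) : T.minStart i r ≤ T.toggleStart i r := by
  have := T.rowStart_le_maxStart i r
  have := T.toggleStart_add i r
  omega

theorem toggleStart_le_maxStart (T : A.SSYT) (i r : ℕ) : T.toggleStart i r ≤ T.maxStart i r := by
  have := T.minStart_le_rowStart i r
  have := T.toggleStart_add i r
  omega

/-- The Bender–Knuth involution, exchanging the multiplicities of `i` and `i + 1`. -/
noncomputable def toggle (i : ℕ) (T : A.SSYT) : A.SSYT where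
  entry c := if T.rowStart i c.1.1 ≤ c.1.2 ∧ c.1.2 < T.rowStart (i + 2) c.1.1 then
    (if c.1.2 < T.toggleStart i c.1.1 then i else i + 1) else T.entry c
  row_weak := by
    rintro ⟨⟨r, j⟩, hc⟩ ⟨⟨r', j'⟩, hd⟩ h1 h2
    dsimp only at h1 h2 ⊢
    subst h1
    have hw := T.row_weak ⟨_, hc⟩ ⟨_, hd⟩ rfl h2
    have hc1 := T.entry_lt_iff i hc
    have hd1 := T.entry_lt_iff i hd
    have hc2 := T.entry_lt_iff (i + 2) hc
    have hd2 := T.entry_lt_iff (i + 2) hd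
    split_ifs <;> omega
  col_strict := by
    rintro ⟨⟨r, j⟩, hc⟩ ⟨⟨r', j'⟩, hd⟩ h1 h2
    dsimp only at h1 h2 ⊢
    subst h1
    have hw := T.col_strict ⟨_, hc⟩ ⟨_, hd⟩ rfl h2
    have hc1 := T.entry_lt_iff i hc
    have hd1 := T.entry_lt_iff i hd
    have hc2 := T.entry_lt_iff (i + 2) hc
    have hd2 := T.entry_lt_iff (i + 2) hd
    -- Two boxes of one column holding values in `{i, i + 1}` must be adjacent. The bounds on the
    -- reflected starts then force `i` above and `i + 1` below.
    by_cases hboth : (T.rowStart i r ≤ j ∧ j < T.rowStart (i + 2) r) ∧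
        T.rowStart i r' ≤ j ∧ j < T.rowStart (i + 2) r'
    · have hr : r' = r + 1 := by
        by_contra hne
        have hm : (r + 1, j) ∈ A.cells :=
          mem_cells_of_between hc hd (by simp) (by simp; omega)
        have := T.col_strict ⟨_, hc⟩ ⟨_, hm⟩ rfl (Nat.lt_succ_self r)
        have := T.col_strict ⟨_, hm⟩ ⟨_, hd⟩ rfl (show r + 1 < r' by omega)
        omega
      subst hr
      have h3 := T.minStart_le_toggleStart i r
      have h4 : T.rowStart (i + 2) (r + 1) ≤ T.minStart i r := le_max_right _ _
      have h5 := T.toggleStart_le_maxStart i (r + 1)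
      have h6 : T.maxStart i (r + 1) ≤ T.rowStart i r := min_le_right _ _
      split_ifs <;> omega
    · split_ifs <;> omega

theorem toggle_entry (i : ℕ) (T : A.SSYT) (c : A.cells) : (toggle i T).entry c =
    if T.rowStart i c.1.1 ≤ c.1.2 ∧ c.1.2 < T.rowStart (i + 2) c.1.1 then
    (if c.1.2 < T.toggleStart i c.1.1 then i else i + 1) else T.entry c := rfl

theorem rowStart_toggle_of_le {i t : ℕ} (T : A.SSYT) (h : t ≤ i ∨ i + 2 ≤ t) (r : ℕ) :
    (toggle i T).rowStart t r = T.rowStart t r := by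
  refine rowStart_eq_of_forall (T.inner_le_rowStart t r) (T.rowStart_le_outer t r) fun j hj => ?_
  rw [toggle_entry]
  have h1 := T.entry_lt_iff i hj
  have h2 := T.entry_lt_iff (i + 2) hj
  have h3 := T.entry_lt_iff t hj
  dsimp only
  split_ifs <;> omega

theorem rowStart_toggle (i : ℕ) (T : A.SSYT) (r : ℕ) :
    (toggle i T).rowStart (i + 1) r = T.toggleStart i r := by
  have h3 := T.minStart_le_toggleStart i r
  have h4 : T.rowStart i r ≤ T.minStart i r := le_max_left _ _
  have h5 := T.toggleStart_le_maxStart i r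
  have h6 := T.maxStart_le i r
  have h7 := T.inner_le_rowStart i r
  have h8 := T.rowStart_le_outer (i + 2) r
  refine rowStart_eq_of_forall (by omega) (by omega) fun j hj => ?_
  rw [toggle_entry]
  have h1 := T.entry_lt_iff i hj
  have h2 := T.entry_lt_iff (i + 2) hj
  dsimp only
  split_ifs <;> omega

theorem toggleStart_toggle (i : ℕ) (T : A.SSYT) (r : ℕ) :
    (toggle i T).toggleStart i r = T.rowStart (i + 1) r := by
  have h1 : (toggle i T).minStart i r = T.minStart i r := by
    unfold minStart
    rw [rowStart_toggle_of_le T (by omega), rowStart_toggle_of_le T (by omega)]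
  have h2 : (toggle i T).maxStart i r = T.maxStart i r := by
    cases r with
    | zero => exact rowStart_toggle_of_le T (by omega) _
    | succ r =>
      simp only [maxStart]
      rw [rowStart_toggle_of_le T (by omega), rowStart_toggle_of_le T (by omega)]
  have h3 := (toggle i T).toggleStart_add i r
  have h4 := T.toggleStart_add i r
  rw [h1, h2, rowStart_toggle] at h3
  omega

theorem toggle_toggle (i : ℕ) (T : A.SSYT) : toggle i (toggle i T) = T := by
  ext ⟨⟨r, j⟩, hc⟩
  rw [toggle_entry, toggle_entry, toggleStart_toggle, rowStart_toggle_of_le T (by omega),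
    rowStart_toggle_of_le T (by omega)]
  have h1 := T.entry_lt_iff i hc
  have h2 := T.entry_lt_iff (i + 1) hc
  have h3 := T.entry_lt_iff (i + 2) hc
  dsimp only
  split_ifs <;> omega

/-- Let `a`, `b`, `c` be the starts for `i`, `i + 1`, `i + 2` in a row, and `b'` the reflection of
`b`. Summed over the rows, `b + b'` equals `a + c`, whence `b' - a` and `c - b` have the same sum.
-/
theorem content_toggle_add (i : ℕ) (T : A.SSYT) :
    (toggle i T).content i = T.content (i + 1) := by
  rw [content_eq_sum_rowStart, content_eq_sum_rowStart]
  -- Below the last row all starts vanish, which removes the boundary terms of the telescoped sum.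
  have hN : T.rowStart (i + 2) (A.outer.colLen 0) = 0 := by
    refine Nat.eq_zero_of_le_zero ((T.rowStart_le_outer _ _).trans (le_of_eq ?_))
    by_contra h
    have := YoungDiagram.mem_iff_lt_rowLen.2 (Nat.pos_of_ne_zero h)
    exact (YoungDiagram.mem_iff_lt_colLen.1 this).false
  have hsum := T.sum_minStart_add_maxStart i (A.outer.colLen 0)
  have h0 := T.maxStart_le i (A.outer.colLen 0)
  rw [hN] at hsum h0
  rw [Nat.eq_zero_of_le_zero h0, add_zero, add_zero] at hsum
  simp only [rowStart_toggle, rowStart_toggle_of_le T (le_refl i |> Or.inl)]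
  have hl : ∀ r, (T.toggleStart i r - T.rowStart i r) + T.rowStart i r + T.rowStart (i + 1) r =
      T.minStart i r + T.maxStart i r := fun r => by
    have h3 := T.minStart_le_toggleStart i r
    have h4 : T.rowStart i r ≤ T.minStart i r := le_max_left _ _
    have := T.toggleStart_add i r
    omega
  have hr : ∀ r, (T.rowStart (i + 1 + 1) r - T.rowStart (i + 1) r) + T.rowStart i r +
      T.rowStart (i + 1) r = T.rowStart i r + T.rowStart (i + 2) r := fun r => by
    have := T.rowStart_mono (show i + 1 ≤ i + 2 by omega) r
    rw [show i + 1 + 1 = i + 2 from rfl]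
    omega
  simp only [← hl, ← hr, Finset.sum_add_distrib] at hsum
  omega

theorem content_toggle (i : ℕ) (T : A.SSYT) :
    (toggle i T).content = T.content.equivMapDomain (Equiv.swap i (i + 1)) := by
  ext t
  rw [Finsupp.equivMapDomain_apply, Equiv.symm_swap]
  rcases eq_or_ne t i with rfl | h1
  · rw [Equiv.swap_apply_left, content_toggle_add]
  rcases eq_or_ne t (i + 1) with rfl | h2
  · rw [Equiv.swap_apply_right, ← content_toggle_add, toggle_toggle]
  rw [Equiv.swap_apply_of_ne_of_ne h1 h2, content_eq_sum_rowStart, content_eq_sum_rowStart]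
  refine Finset.sum_congr rfl fun r _ => ?_
  rw [rowStart_toggle_of_le T (by omega), rowStart_toggle_of_le T (by omega)]

end SkewShape.SSYT

/-- Invariance of a power series under exchange of two adjacent variables. -/
def IsSymmSeries (f : MvPowerSeries ℕ ℚ) : Prop :=
  ∀ (i : ℕ) (d : ℕ →₀ ℕ), MvPowerSeries.coeff (d.equivMapDomain (Equiv.swap i (i + 1))) f =
    MvPowerSeries.coeff d f

theorem isSymmSeries_skewSchur (A : SkewShape) : IsSymmSeries (skewSchur A) := by
  intro i d
  rw [coeff_skewSchur, coeff_skewSchur, Nat.cast_inj]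
  have hinv : ∀ d : ℕ →₀ ℕ, (d.equivMapDomain (Equiv.swap i (i + 1))).equivMapDomain
      (Equiv.swap i (i + 1)) = d := fun d => by
    ext t; simp [Finsupp.equivMapDomain_apply]
  refine Nat.card_congr ⟨fun T => ⟨T.1.toggle i, ?_⟩, fun T => ⟨T.1.toggle i, ?_⟩, fun T => ?_,
    fun T => ?_⟩
  · rw [SkewShape.SSYT.content_toggle, T.2, hinv]
  · rw [SkewShape.SSYT.content_toggle, T.2]
  · exact Subtype.ext (T.1.toggle_toggle i)
  · exact Subtype.ext (T.1.toggle_toggle i)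

/-! ### Linear independence of Schur functions by peeling off first rows. -/

namespace YoungDiagram

theorem tailRows_injOn (M : ℕ) : Set.InjOn tailRows {ν : YoungDiagram | ν.rowLen 0 = M} := by
  intro ν hν ρ hρ h
  rw [Set.mem_ofPred_eq] at hν hρ
  ext ⟨i, j⟩
  rw [mem_cells, mem_cells]
  cases i with
  | zero => rw [mem_iff_lt_rowLen, mem_iff_lt_rowLen, hν, hρ]
  | succ i => rw [← mem_tailRows, ← mem_tailRows, h]

theorem card_tailRows_lt {ν : YoungDiagram} (h : 0 < ν.rowLen 0) : ν.tailRows.card < ν.card := by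
  refine Finset.card_image_le.trans_lt (Finset.card_lt_card ?_)
  rw [Finset.filter_ssubset]
  exact ⟨(0, 0), mem_iff_lt_rowLen.2 h, by simp⟩

theorem eq_bot_of_rowLen_zero {ν : YoungDiagram} (h : ν.rowLen 0 = 0) : ν = ⊥ := by
  ext ⟨i, j⟩
  simp only [mem_cells, notMem_bot, iff_false]
  intro hm
  have := mem_iff_lt_rowLen.1 (ν.up_left_mem (Nat.zero_le _) le_rfl hm)
  omega

/-- The Young diagram with a first row of length `M` placed above the first `M` columns of `ρ`. -/
def consRow (M : ℕ) (ρ : YoungDiagram) : YoungDiagram where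
  cells := ((Finset.range M).image fun j => (0, j)) ∪
    ((ρ.cells.filter fun c => c.2 < M).image fun c => (c.1 + 1, c.2))
  isLowerSet := by
    rintro ⟨a, b⟩ ⟨i, j⟩ hle hm
    obtain ⟨h1, h2⟩ := Prod.mk_le_mk.1 hle
    simp only [Finset.coe_union, Finset.coe_image, Finset.coe_range, Finset.coe_filter,
      Set.mem_union, Set.mem_image, Set.mem_Iio, Prod.mk.injEq, Set.mem_ofPred_eq, mem_cells]
      at hm ⊢
    rcases hm with ⟨x, hx, h3, h4⟩ | ⟨⟨x, y⟩, ⟨h5, h6⟩, h3, h4⟩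
    · exact Or.inl ⟨j, by omega, by omega, rfl⟩
    · simp only at h3 h4 h6
      cases i with
      | zero => exact Or.inl ⟨j, by omega, rfl, rfl⟩
      | succ i =>
        exact Or.inr ⟨(i, j), ⟨ρ.up_left_mem (by omega) (by omega) h5, by simp only; omega⟩, rfl, rfl⟩

theorem card_consRow_le (M : ℕ) (ρ : YoungDiagram) : (consRow M ρ).card ≤ M + ρ.card := by
  refine (Finset.card_union_le _ _).trans (Nat.add_le_add ?_ ?_)
  · exact Finset.card_image_le.trans (Finset.card_range M).le
  · exact Finset.card_image_le.trans (Finset.card_filter_le _ _)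

theorem rowLen_consRow (M : ℕ) (ρ : YoungDiagram) : (consRow M ρ).rowLen 0 = M := by
  have h : ∀ j, j < (consRow M ρ).rowLen 0 ↔ j < M := fun j => by
    rw [← mem_iff_lt_rowLen, ← mem_cells]
    simp [consRow]
  have h1 := h M
  have h2 := h ((consRow M ρ).rowLen 0)
  omega

theorem tailRows_consRow {M : ℕ} {ρ : YoungDiagram} (h : ρ.rowLen 0 ≤ M) :
    (consRow M ρ).tailRows = ρ := by
  ext ⟨i, j⟩
  rw [mem_cells, mem_cells, mem_tailRows, ← mem_cells]
  simp only [consRow, Finset.mem_union, Finset.mem_image, Finset.mem_range, Prod.mk.injEq,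
    Nat.right_eq_add, Finset.mem_filter, mem_cells]
  constructor
  · rintro (⟨x, -, h1, -⟩ | ⟨⟨x, y⟩, ⟨h1, -⟩, h2, h3⟩)
    · omega
    · simp only at h2 h3
      obtain rfl : x = i := by omega
      rwa [← h3]
  · intro hm
    refine Or.inr ⟨(i, j), ⟨hm, ?_⟩, rfl, rfl⟩
    exact (mem_iff_lt_rowLen.1 (ρ.up_left_mem (Nat.zero_le _) le_rfl hm)).trans_le h

end YoungDiagram

theorem headCoeff_schur (ν : YoungDiagram) :
    headCoeff (ν.rowLen 0) (schur ν) = schur ν.tailRows := by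
  rw [schur, ← SkewShape.numCols_straight, headCoeff_skewSchur, SkewShape.straight_shrink, schur]

theorem headCoeff_schur_of_lt {ν : YoungDiagram} {M : ℕ} (h : ν.rowLen 0 < M) :
    headCoeff M (schur ν) = 0 :=
  headCoeff_skewSchur_of_lt (by rwa [SkewShape.numCols_straight])

/-- Diagrams with first row shorter than `M` have too few columns to contribute; those with first
row `M` lose it. -/
theorem headCoeff_linearCombination_schur {M : ℕ} {c : YoungDiagram →₀ ℚ}
    (h : ∀ ν ∈ c.support, ν.rowLen 0 ≤ M) :
    headCoeff M (Finsupp.linearCombination ℚ schur c) = Finsupp.linearCombination ℚ schur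
      ((c.filter fun ν => ν.rowLen 0 = M).mapDomain YoungDiagram.tailRows) := by
  rw [Finsupp.linearCombination_mapDomain, Finsupp.linearCombination_apply,
    Finsupp.linearCombination_apply, Finsupp.sum, Finsupp.sum, Finsupp.support_filter,
    Finset.sum_filter, map_sum]
  refine Finset.sum_congr rfl fun ν hν => ?_
  rw [map_smul]
  split_ifs with hM
  · rw [Finsupp.filter_apply, if_pos hM, Function.comp, ← headCoeff_schur, hM]
  · rw [headCoeff_schur_of_lt ((h ν hν).lt_of_ne hM), smul_zero]

/-- Diagrams with a common first row length are distinguished by their tails, so `mapDomain` merges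
no coefficients and nothing cancels. -/
theorem support_filter_mapDomain_tailRows (c : YoungDiagram →₀ ℚ) (M : ℕ) :
    (((c.filter fun ν => ν.rowLen 0 = M).mapDomain YoungDiagram.tailRows).support :
      Set YoungDiagram) =
      YoungDiagram.tailRows '' {ν | ν ∈ c.support ∧ ν.rowLen 0 = M} := by
  classical
  rw [Finsupp.mapDomain_support_of_injOn]
  · rw [Finset.coe_image]
    congr 1
    ext ν
    simp
  · refine (YoungDiagram.tailRows_injOn M).mono fun ν hν => ?_
    simp only [Finsupp.support_filter, Finset.coe_filter, Set.mem_ofPred_eq] at hν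
    exact hν.2

theorem coeff_zero_schur_bot : MvPowerSeries.coeff 0 (schur ⊥) = 1 := by
  have hcells : (SkewShape.straight ⊥).cells = ∅ := by
    simp [SkewShape.cells, SkewShape.straight]
  have : IsEmpty (SkewShape.straight ⊥).cells := by
    rw [hcells]; infer_instance
  rw [schur, coeff_skewSchur, Nat.cast_eq_one, Nat.card_eq_one_iff_unique]
  refine ⟨⟨fun T U => Subtype.ext (SkewShape.SSYT.ext fun c => isEmptyElim c)⟩, ?_⟩
  obtain ⟨T⟩ := (inferInstance : Nonempty (SkewShape.straight ⊥).SSYT)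
  exact ⟨T, by simp [SkewShape.SSYT.content]⟩

/-- Take the top power of `x_0`, given by the longest first row in the support. The result is a
relation among smaller diagrams, trivial by induction, although the tail of the extremal diagram
occurs in it. If that row is empty, the constant term decides. -/
theorem schur_linearCombination_eq_zero {c : YoungDiagram →₀ ℚ}
    (hc : Finsupp.linearCombination ℚ schur c = 0) : c = 0 := by
  obtain ⟨N, hN⟩ : ∃ N, ∀ ν ∈ c.support, ν.card ≤ N :=
    ⟨c.support.sup YoungDiagram.card, fun ν hν => Finset.le_sup (f := YoungDiagram.card) hν⟩
  induction N using Nat.strong_induction_on generalizing c with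
  | _ N ih =>
    by_contra hne
    obtain ⟨ν, hν, hmax⟩ := Finset.exists_max_image c.support (fun ν => ν.rowLen 0)
      (Finsupp.support_nonempty_iff.2 hne)
    rcases Nat.eq_zero_or_pos (ν.rowLen 0) with h0 | hpos
    · have hbot : ∀ ρ ∈ c.support, ρ = ⊥ := fun ρ hρ =>
        YoungDiagram.eq_bot_of_rowLen_zero (by have := hmax ρ hρ; omega)
      have hs : c = Finsupp.single ⊥ (c ⊥) :=
        Finsupp.eq_single_iff.2 ⟨fun ρ hρ => Finset.mem_singleton.2 (hbot ρ hρ), rfl⟩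
      rw [hs, Finsupp.linearCombination_single] at hc
      have h1 := congrArg (MvPowerSeries.coeff 0) hc
      rw [map_smul, coeff_zero_schur_bot, map_zero, smul_eq_mul, mul_one] at h1
      rw [h1, Finsupp.single_zero] at hs
      exact hne hs
    · have hh := headCoeff_linearCombination_schur hmax
      rw [hc, map_zero] at hh
      have hsupp := support_filter_mapDomain_tailRows c (ν.rowLen 0)
      have hz := ih (N - 1) (by have := hN ν hν; have := YoungDiagram.card_tailRows_lt hpos; omega)
        hh.symm fun ρ hρ => by
          rw [← Finset.mem_coe, hsupp] at hρ
          obtain ⟨σ, ⟨hσ, hσM⟩, rfl⟩ := hρ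
          have h1 := YoungDiagram.card_tailRows_lt (ν := σ) (by omega)
          have h2 := hN σ hσ
          omega
      rw [hz] at hsupp
      have : ν.tailRows ∈ (∅ : Set YoungDiagram) := by
        have h3 : ν.tailRows ∈ YoungDiagram.tailRows ''
          {ρ | ρ ∈ c.support ∧ ρ.rowLen 0 = ν.rowLen 0} := ⟨ν, ⟨hν, rfl⟩, rfl⟩
        rw [← hsupp] at h3
        simp at h3
      exact this

theorem schur_linearCombination_injective :
    Function.Injective (Finsupp.linearCombination ℚ schur) :=
  (injective_iff_map_eq_zero _).2 fun _ => schur_linearCombination_eq_zero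

/-! ### Symmetric series of bounded degree are combinations of Schur functions. -/

namespace IsSymmSeries

theorem headCoeff {f : MvPowerSeries ℕ ℚ} (hf : IsSymmSeries f) (M : ℕ) :
    IsSymmSeries (headCoeff M f) := by
  intro i d
  rw [coeff_headCoeff, coeff_headCoeff, ← hf (i + 1)]
  congr 2
  ext t
  rw [Finsupp.equivMapDomain_apply, Equiv.symm_swap]
  cases t with
  | zero => rw [Equiv.swap_apply_of_ne_of_ne (by omega) (by omega)]; simp
  | succ t =>
    rw [Finsupp.natCons_succ]
    rcases eq_or_ne t i with rfl | h1
    · rw [Equiv.swap_apply_left, Finsupp.natCons_succ, Finsupp.equivMapDomain_apply]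
      simp
    rcases eq_or_ne t (i + 1) with rfl | h2
    · rw [Equiv.swap_apply_right, Finsupp.natCons_succ, Finsupp.equivMapDomain_apply]
      simp
    rw [Equiv.swap_apply_of_ne_of_ne (by omega) (by omega), Finsupp.natCons_succ,
      Finsupp.equivMapDomain_apply, Equiv.symm_swap, Equiv.swap_apply_of_ne_of_ne h1 h2]

theorem sub {f g : MvPowerSeries ℕ ℚ} (hf : IsSymmSeries f) (hg : IsSymmSeries g) :
    IsSymmSeries (f - g) := by
  intro i d
  rw [map_sub, map_sub, hf, hg]

theorem linearCombination_schur (c : YoungDiagram →₀ ℚ) :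
    IsSymmSeries (Finsupp.linearCombination ℚ schur c) := by
  intro i d
  rw [Finsupp.linearCombination_apply, Finsupp.sum, map_sum, map_sum]
  refine Finset.sum_congr rfl fun ν _ => ?_
  rw [map_smul, map_smul, schur, isSymmSeries_skewSchur]

/-- Adjacent swaps carry any nonzero exponent to position `0`. -/
theorem coeff_eq_zero_of_ne_zero {f : MvPowerSeries ℕ ℚ} (hf : IsSymmSeries f)
    (h : ∀ d : ℕ →₀ ℕ, d 0 ≠ 0 → MvPowerSeries.coeff d f = 0) {d : ℕ →₀ ℕ} (hd : d ≠ 0) :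
    MvPowerSeries.coeff d f = 0 := by
  obtain ⟨i, hi⟩ := Finsupp.ne_iff.1 hd
  rw [Finsupp.coe_zero, Pi.zero_apply] at hi
  clear hd
  induction i generalizing d with
  | zero => exact h d hi
  | succ i ih =>
    rw [← hf i d]
    refine ih ?_
    rwa [Finsupp.equivMapDomain_apply, Equiv.symm_swap, Equiv.swap_apply_left]

/-- A symmetric power series of bounded degree is a linear combination of Schur functions. -/
theorem exists_linearCombination_schur {f : MvPowerSeries ℕ ℚ} (hf : IsSymmSeries f) {n M : ℕ}
    (hn : ∀ d : ℕ →₀ ℕ, n < d.degree → MvPowerSeries.coeff d f = 0)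
    (hM : ∀ d : ℕ →₀ ℕ, M < d 0 → MvPowerSeries.coeff d f = 0) :
    ∃ c : YoungDiagram →₀ ℚ, Finsupp.linearCombination ℚ schur c = f ∧
      ∀ ν ∈ c.support, ν.card ≤ n ∧ ν.rowLen 0 ≤ M := by
  induction n using Nat.strong_induction_on generalizing f M with
  | _ n ihn =>
  induction M generalizing f with
  | zero =>
    refine ⟨Finsupp.single ⊥ (MvPowerSeries.coeff 0 f), ?_, fun ν hν => ?_⟩
    · rw [Finsupp.linearCombination_single]
      ext d
      rw [map_smul]
      rcases eq_or_ne d 0 with rfl | hd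
      · rw [coeff_zero_schur_bot, smul_eq_mul, mul_one]
      · rw [hf.coeff_eq_zero_of_ne_zero (fun d hd => hM d (Nat.pos_of_ne_zero hd)) hd, schur,
          coeff_skewSchur_eq_zero_of_degree_ne, smul_zero]
        rw [ne_eq, SkewShape.cells, SkewShape.straight]
        simpa [Finsupp.degree_eq_zero_iff] using hd
    · obtain rfl := Finset.mem_singleton.1 (Finsupp.support_single_subset hν)
      refine ⟨Nat.zero_le n, ?_⟩
      by_contra! h
      simpa using YoungDiagram.mem_iff_lt_rowLen.2 h
  | succ M ihM =>
    -- If `n ≤ M`, the degree bound already excludes the exponent `M + 1` of `x_0`. Otherwise `n -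
    -- (M + 1)` is a genuine difference bounding the degree of the head coefficient.
    rcases Nat.lt_or_ge n (M + 1) with hlt | hge
    · obtain ⟨c, hc, hc'⟩ := ihM hf hn fun d hd => hn d (by
        have : d 0 ≤ d.degree := Finsupp.le_degree 0 d
        omega)
      exact ⟨c, hc, fun ν hν => ⟨(hc' ν hν).1, (hc' ν hν).2.trans (Nat.le_succ M)⟩⟩
    · obtain ⟨c, hc, hc'⟩ := ihn (n - (M + 1)) (by omega) (hf.headCoeff (M + 1)) (M := M + 1)
        (fun d hd => by
          rw [coeff_headCoeff]
          exact hn _ (by rw [Finsupp.natCons_degree]; omega))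
        -- The first variable of the head coefficient is `x_1` of `f`; symmetry transfers the bound
        -- from `x_0` to it.
        (fun d hd => by
          rw [coeff_headCoeff, ← hf 0]
          refine hM _ ?_
          rw [Finsupp.equivMapDomain_apply, Equiv.symm_swap, Equiv.swap_apply_left,
            Finsupp.natCons_succ]
          exact hd)
      -- A row of length `M + 1` is put on top of each diagram. First rows below it are at most that
      -- long, so `consRow` cuts nothing off and the head coefficient of `f` is matched.
      set c₁ := c.mapDomain (YoungDiagram.consRow (M + 1)) with hc₁
      have hsupp : ∀ ν ∈ c₁.support, ν.card ≤ n ∧ ν.rowLen 0 = M + 1 := by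
        classical
        intro ν hν
        obtain ⟨ρ, hρ, rfl⟩ := Finset.mem_image.1 (Finsupp.mapDomain_support hν)
        have h1 := (hc' ρ hρ).1
        have h2 := YoungDiagram.card_consRow_le (M + 1) ρ
        exact ⟨by omega, YoungDiagram.rowLen_consRow _ _⟩
      have hhead : _root_.headCoeff (M + 1) (Finsupp.linearCombination ℚ schur c₁) =
          _root_.headCoeff (M + 1) f := by
        rw [headCoeff_linearCombination_schur fun ν hν => (hsupp ν hν).2.le, ← hc,
          (Finsupp.filter_eq_self_iff _ _).2
            (fun ν hν => (hsupp ν (Finsupp.mem_support_iff.2 hν)).2), hc₁,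
          ← Finsupp.mapDomain_comp]
        congr 1
        conv_rhs => rw [← Finsupp.mapDomain_id (v := c)]
        exact Finsupp.mapDomain_congr fun ρ hρ => YoungDiagram.tailRows_consRow (hc' ρ hρ).2
      have hzero : ∀ d : ℕ →₀ ℕ, (n < d.degree ∨ M + 1 < d 0) →
          MvPowerSeries.coeff d (Finsupp.linearCombination ℚ schur c₁) = 0 := by
        intro d hd
        rw [Finsupp.linearCombination_apply, Finsupp.sum, map_sum]
        refine Finset.sum_eq_zero fun ν hν => ?_
        have hν' := hsupp ν hν
        rw [map_smul, schur]
        rcases hd with hd | hd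
        · rw [coeff_skewSchur_eq_zero_of_degree_ne, smul_zero]
          simp only [SkewShape.cells, SkewShape.straight, YoungDiagram.cells_bot,
            Finset.sdiff_empty]
          exact (hν'.1.trans_lt hd).ne'
        · rw [coeff_skewSchur_eq_zero_of_numCols_lt, smul_zero]
          rwa [SkewShape.numCols_straight, hν'.2]
      -- The power `x_0 ^ (M + 1)` cancels in the difference, so the induction on `M` applies.
      obtain ⟨c₂, hc₂, hc₂'⟩ := ihM (f := f - Finsupp.linearCombination ℚ schur c₁)
        (hf.sub (linearCombination_schur c₁))
        (fun d hd => by rw [map_sub, hn d hd, hzero d (Or.inl hd), sub_zero])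
        (fun d hd => by
          rw [map_sub]
          rcases (Nat.succ_le_of_lt hd).eq_or_lt with h | h
          · obtain ⟨d', hd'⟩ := d.exists_eq_natCons
            rw [← h] at hd'
            rw [hd', ← coeff_headCoeff, ← coeff_headCoeff, hhead, sub_self]
          · rw [hM d h, hzero d (Or.inr h), sub_zero])
      refine ⟨c₁ + c₂, by rw [map_add, hc₂, add_sub_cancel], fun ν hν => ?_⟩
      classical
      rcases Finset.mem_union.1 (Finsupp.support_add hν) with h | h
      · exact ⟨(hsupp ν h).1, (hsupp ν h).2.le⟩
      · exact ⟨(hc₂' ν h).1, (hc₂' ν h).2.trans (Nat.le_succ M)⟩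

end IsSymmSeries

/-! ### Schur supports under `shrink`. -/

/-- `schurSupport` quantifies over expansions, so without existence it could be empty and carry no
information. -/
theorem exists_linearCombination_schur_eq_skewSchur (A : SkewShape) :
    ∃ c : YoungDiagram →₀ ℚ, Finsupp.linearCombination ℚ schur c = skewSchur A := by
  obtain ⟨c, hc, -⟩ := (isSymmSeries_skewSchur A).exists_linearCombination_schur
    (n := A.cells.card) (M := A.numCols)
    (fun d hd => coeff_skewSchur_eq_zero_of_degree_ne hd.ne')
    (fun d hd => coeff_skewSchur_eq_zero_of_numCols_lt hd)
  exact ⟨c, hc⟩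

theorem schurSupport_eq {A : SkewShape} {c : YoungDiagram →₀ ℚ}
    (hc : Finsupp.linearCombination ℚ schur c = skewSchur A) :
    schurSupport A = c.support := by
  ext ν
  rw [Finset.mem_coe, Finsupp.mem_support_iff]
  constructor
  · rintro ⟨c', hc', h⟩
    rwa [← schur_linearCombination_injective (hc'.trans hc.symm)]
  · exact fun h => ⟨c, hc, h⟩

/-- By homogeneity, keeping only the diagrams with as many boxes as `A` yields another expansion of
`s_A`; expansions are unique. -/
theorem card_eq_of_mem_schurSupport {A : SkewShape} {ν : YoungDiagram} (h : ν ∈ schurSupport A) :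
    ν.card = A.cells.card := by
  obtain ⟨c, hc, hν⟩ := h
  have hc' : Finsupp.linearCombination ℚ schur (c.filter fun ρ => ρ.card = A.cells.card) =
      skewSchur A := by
    ext d
    rw [Finsupp.linearCombination_apply, Finsupp.sum, Finsupp.support_filter, Finset.sum_filter,
      map_sum]
    have hterm : ∀ ρ : YoungDiagram, d.degree ≠ ρ.card →
        MvPowerSeries.coeff d (schur ρ) = 0 := fun ρ hρ =>
      coeff_skewSchur_eq_zero_of_degree_ne (by simpa [SkewShape.cells, SkewShape.straight] using hρ)
    by_cases hd : d.degree = A.cells.card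
    · rw [← hc, Finsupp.linearCombination_apply, Finsupp.sum, map_sum]
      refine Finset.sum_congr rfl fun ρ _ => ?_
      split_ifs with hρ
      · rw [Finsupp.filter_apply, if_pos hρ]
      · rw [map_zero, map_smul, hterm ρ (by rw [hd]; exact Ne.symm hρ), smul_zero]
    · rw [coeff_skewSchur_eq_zero_of_degree_ne hd]
      refine Finset.sum_eq_zero fun ρ _ => ?_
      split_ifs with hρ
      · rw [map_smul, hterm ρ (by rwa [hρ]), smul_zero]
      · rw [map_zero]
  by_contra hne
  have := schur_linearCombination_injective (hc'.trans hc.symm)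
  rw [← this, Finsupp.filter_apply, if_neg hne] at hν
  exact hν rfl

theorem schurSupport_nonempty (A : SkewShape) : (schurSupport A).Nonempty := by
  obtain ⟨c, hc⟩ := exists_linearCombination_schur_eq_skewSchur A
  rw [schurSupport_eq hc, Finset.coe_nonempty, Finsupp.support_nonempty_iff]
  rintro rfl
  rw [map_zero] at hc
  exact skewSchur_ne_zero A hc.symm

/-- A first row longer than `numCols` would leave a nontrivial combination of Schur functions as
head coefficient, where that of `s_A` is zero. -/
theorem rowLen_le_of_mem_schurSupport {A : SkewShape} {ν : YoungDiagram}
    (h : ν ∈ schurSupport A) : ν.rowLen 0 ≤ A.numCols := by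
  obtain ⟨c, hc⟩ := exists_linearCombination_schur_eq_skewSchur A
  rw [schurSupport_eq hc, Finset.mem_coe] at h
  obtain ⟨ρ, hρ, hmax⟩ := Finset.exists_max_image c.support (fun ν => ν.rowLen 0) ⟨ν, h⟩
  refine (hmax ν h).trans ?_
  by_contra! hlt
  have hh := headCoeff_linearCombination_schur hmax
  rw [hc, headCoeff_skewSchur_of_lt hlt] at hh
  have hsupp := support_filter_mapDomain_tailRows c (ρ.rowLen 0)
  rw [schur_linearCombination_eq_zero hh.symm] at hsupp
  have h3 : ρ.tailRows ∈ YoungDiagram.tailRows ''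
    {σ | σ ∈ c.support ∧ σ.rowLen 0 = ρ.rowLen 0} := ⟨ρ, ⟨hρ, rfl⟩, rfl⟩
  rw [← hsupp] at h3
  simp at h3

theorem schurSupport_shrink (A : SkewShape) : schurSupport A.shrink =
    YoungDiagram.tailRows '' {ν | ν ∈ schurSupport A ∧ ν.rowLen 0 = A.numCols} := by
  obtain ⟨c, hc⟩ := exists_linearCombination_schur_eq_skewSchur A
  have hh := headCoeff_linearCombination_schur (M := A.numCols) (c := c) fun ν hν =>
    rowLen_le_of_mem_schurSupport (by rw [schurSupport_eq hc]; exact hν)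
  rw [hc, headCoeff_skewSchur] at hh
  rw [schurSupport_eq hh.symm, support_filter_mapDomain_tailRows, schurSupport_eq hc]
  rfl

/-- The bound `numCols` is attained because `A.shrink` has nonempty support. Hence the Schur support
determines `numCols`. -/
theorem exists_mem_schurSupport_rowLen_eq (A : SkewShape) :
    ∃ ν ∈ schurSupport A, ν.rowLen 0 = A.numCols := by
  have h := schurSupport_nonempty A.shrink
  rw [schurSupport_shrink, Set.image_nonempty] at h
  exact h

theorem numCols_le_of_schurSupport_subset {A B : SkewShape} (h : schurSupport A ⊆ schurSupport B) :
    A.numCols ≤ B.numCols := by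
  obtain ⟨ν, hν, hA⟩ := exists_mem_schurSupport_rowLen_eq A
  rw [← hA]
  exact rowLen_le_of_mem_schurSupport (h hν)

theorem schurSupport_shrink_eq_of_eq {A B : SkewShape} (h : schurSupport A = schurSupport B) :
    schurSupport A.shrink = schurSupport B.shrink := by
  rw [schurSupport_shrink, schurSupport_shrink, h,
    (numCols_le_of_schurSupport_subset h.le).antisymm (numCols_le_of_schurSupport_subset h.ge)]

theorem card_eq_of_schurSupport_eq {A B : SkewShape} (h : schurSupport A = schurSupport B) :
    A.cells.card = B.cells.card := by
  obtain ⟨ν, hν⟩ := schurSupport_nonempty A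
  rw [← card_eq_of_mem_schurSupport hν, card_eq_of_mem_schurSupport (h ▸ hν)]

/-! ### Standardization, and standard tableaux by descent set. -/

namespace Finsupp

/-- The sum of the first `t` values of `d`. -/
def psum (d : ℕ →₀ ℕ) (t : ℕ) : ℕ := ∑ i ∈ Finset.range t, d i

theorem psum_zero (d : ℕ →₀ ℕ) : d.psum 0 = 0 := rfl

theorem psum_succ (d : ℕ →₀ ℕ) (t : ℕ) : d.psum (t + 1) = d.psum t + d t :=
  Finset.sum_range_succ _ _

theorem psum_mono (d : ℕ →₀ ℕ) : Monotone d.psum :=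
  monotone_nat_of_le_succ fun t => by rw [psum_succ]; exact Nat.le_add_right _ _

theorem exists_psum_eq_degree (d : ℕ →₀ ℕ) : ∃ N, ∀ t, N ≤ t → d.psum t = d.degree := by
  refine ⟨d.support.sup id + 1, fun t ht => ?_⟩
  rw [degree_apply, psum]
  refine (Finset.sum_subset (fun i hi => ?_) fun i _ hi => ?_).symm
  · have := Finset.le_sup (f := id) hi
    rw [Finset.mem_range]
    simp only [id] at this
    omega
  · exact notMem_support_iff.1 hi

theorem psum_le_degree (d : ℕ →₀ ℕ) (t : ℕ) : d.psum t ≤ d.degree := by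
  obtain ⟨N, hN⟩ := d.exists_psum_eq_degree
  rw [← hN (max N t) (le_max_left _ _)]
  exact d.psum_mono (le_max_right _ _)

/-- The index of the block containing the position `p`, when the positions are cut into
consecutive blocks of sizes `d 0, d 1, …`. -/
noncomputable def blockIndex (d : ℕ →₀ ℕ) (p : ℕ) : ℕ := sInf {t | p < d.psum (t + 1)}

theorem lt_psum_blockIndex_succ {d : ℕ →₀ ℕ} {p : ℕ} (hp : p < d.degree) :
    p < d.psum (d.blockIndex p + 1) := by
  refine Nat.sInf_mem (s := {t | p < d.psum (t + 1)}) ?_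
  obtain ⟨N, hN⟩ := d.exists_psum_eq_degree
  exact ⟨N, by rw [Set.mem_ofPred_eq, hN _ (Nat.le_succ N)]; exact hp⟩

theorem psum_blockIndex_le (d : ℕ →₀ ℕ) (p : ℕ) : d.psum (d.blockIndex p) ≤ p := by
  rcases h : d.blockIndex p with _ | t
  · exact Nat.zero_le _
  · by_contra! hlt
    exact Nat.notMem_of_lt_sInf (s := {t | p < d.psum (t + 1)}) (m := t)
      (by change t < d.blockIndex p; omega) hlt

theorem blockIndex_eq_iff {d : ℕ →₀ ℕ} {p t : ℕ} (hp : p < d.degree) :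
    d.blockIndex p = t ↔ d.psum t ≤ p ∧ p < d.psum (t + 1) := by
  have h1 := lt_psum_blockIndex_succ hp
  have h2 := d.psum_blockIndex_le p
  constructor
  · rintro rfl
    exact ⟨h2, h1⟩
  · rintro ⟨h3, h4⟩
    rcases lt_trichotomy (d.blockIndex p) t with h | h | h
    · have := d.psum_mono (Nat.succ_le_of_lt h)
      simp only [Nat.succ_eq_add_one] at this
      omega
    · exact h
    · have := d.psum_mono (Nat.succ_le_of_lt h)
      simp only [Nat.succ_eq_add_one] at this
      omega

theorem blockIndex_mono {d : ℕ →₀ ℕ} {p q : ℕ} (hpq : p ≤ q) (hq : q < d.degree) :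
    d.blockIndex p ≤ d.blockIndex q :=
  Nat.sInf_le (hpq.trans_lt (lt_psum_blockIndex_succ hq))

open Classical in
/-- The positions strictly between `0` and `|d|` that are partial sums of `d`. -/
noncomputable def breaks (d : ℕ →₀ ℕ) : Finset ℕ :=
  (Finset.Ioo 0 d.degree).filter fun x => ∃ t, d.psum t = x

theorem mem_breaks {d : ℕ →₀ ℕ} {x : ℕ} :
    x ∈ d.breaks ↔ (0 < x ∧ x < d.degree) ∧ ∃ t, d.psum t = x := by
  simp [breaks]

theorem breaks_subset (d : ℕ →₀ ℕ) : d.breaks ⊆ Finset.Ioo 0 d.degree :=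
  fun _ hx => Finset.mem_Ioo.2 (mem_breaks.1 hx).1

end Finsupp

namespace SkewShape

variable {A : SkewShape}

/-- A tableau is standard if its entries are `0, …, n - 1`, where `n` is its size. -/
structure SSYT.IsStandard (T : A.SSYT) : Prop where
  injective : Function.Injective T.entry
  lt_card : ∀ c, T.entry c < A.cells.card

namespace SSYT

theorem IsStandard.entry_lt_entry {T : A.SSYT} (hT : T.IsStandard) {c d : A.cells}
    (h : c.1 ≤ d.1) (hne : c ≠ d) : T.entry c < T.entry d :=
  (T.entry_le_of_le h).lt_of_ne fun h' => hne (hT.injective h')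

theorem IsStandard.exists_entry_eq {T : A.SSYT} (hT : T.IsStandard) {p : ℕ}
    (hp : p < A.cells.card) : ∃ c, T.entry c = p := by
  have h : Finset.univ.image T.entry = Finset.range A.cells.card := by
    refine Finset.eq_of_subset_of_card_le ?_ ?_
    · intro q hq
      obtain ⟨c, -, rfl⟩ := Finset.mem_image.1 hq
      exact Finset.mem_range.2 (hT.lt_card c)
    · rw [Finset.card_image_of_injective _ hT.injective, Finset.card_range, Finset.card_univ,
        Fintype.card_coe]
  have hp' := Finset.mem_range.2 hp
  rw [← h] at hp'
  obtain ⟨c, -, hc⟩ := Finset.mem_image.1 hp'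
  exact ⟨c, hc⟩

/-- An entry is the rank of its box, so a standard tableau is determined by the order it puts on the
boxes. -/
theorem IsStandard.card_filter_lt {T : A.SSYT} (hT : T.IsStandard) (c : A.cells) :
    (Finset.univ.filter fun d => T.entry d < T.entry c).card = T.entry c := by
  conv_rhs => rw [← Finset.card_range (T.entry c)]
  refine Finset.card_bij (fun d _ => T.entry d) ?_ ?_ ?_
  · intro d hd
    simpa using hd
  · intro d _ e _ h
    exact hT.injective h
  · intro p hp
    rw [Finset.mem_range] at hp
    obtain ⟨d, rfl⟩ := hT.exists_entry_eq (hp.trans (hT.lt_card c))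
    exact ⟨d, by simpa using hp, rfl⟩

open Classical in
/-- The descents of a tableau: the positive `i` such that the entry `i` lies in a lower row than the
entry `i - 1`. -/
noncomputable def descents (T : A.SSYT) : Finset ℕ :=
  (Finset.Ioo 0 A.cells.card).filter fun i =>
    ∃ c d : A.cells, T.entry c + 1 = i ∧ T.entry d = i ∧ c.1.1 < d.1.1

theorem descents_subset (T : A.SSYT) : T.descents ⊆ Finset.Ioo 0 A.cells.card :=
  Finset.filter_subset _ _

theorem IsStandard.mem_descents_iff {T : A.SSYT} (hT : T.IsStandard) {c d : A.cells}
    (h : T.entry c + 1 = T.entry d) : T.entry d ∈ T.descents ↔ c.1.1 < d.1.1 := by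
  simp only [descents, Finset.mem_filter, Finset.mem_Ioo]
  constructor
  · rintro ⟨-, c', d', h1, h2, h3⟩
    obtain rfl : c' = c := hT.injective (by omega)
    obtain rfl : d' = d := hT.injective h2
    exact h3
  · intro h'
    exact ⟨⟨by omega, hT.lt_card d⟩, c, d, h, rfl, h'⟩

/-- Consecutive entries move either to a lower row or to a later column, but not both. -/
theorem IsStandard.col_lt_iff {T : A.SSYT} (hT : T.IsStandard) {c d : A.cells}
    (h : T.entry c + 1 = T.entry d) : c.1.2 < d.1.2 ↔ ¬ c.1.1 < d.1.1 := by
  constructor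
  · intro h2 h1
    -- A move both down and right would leave this corner with an entry strictly between two
    -- consecutive integers.
    have he : (d.1.1, c.1.2) ∈ A.cells :=
      mem_cells_of_between c.2 d.2 (Prod.mk_le_mk.2 ⟨h1.le, le_rfl⟩) (Prod.mk_le_mk.2 ⟨le_rfl, h2.le⟩)
    have h3 := hT.entry_lt_entry (c := c) (d := ⟨_, he⟩) (Prod.mk_le_mk.2 ⟨h1.le, le_rfl⟩)
      (fun h => by rw [h] at h1; exact h1.false)
    have h4 := hT.entry_lt_entry (c := ⟨_, he⟩) (d := d) (Prod.mk_le_mk.2 ⟨le_rfl, h2.le⟩)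
      (fun h => by rw [← h] at h2; exact h2.false)
    omega
  · intro h1
    by_contra h2
    have := T.entry_le_of_le (c := d) (d := c) (Prod.mk_le_mk.2 ⟨not_lt.1 h1, not_lt.1 h2⟩)
    omega

/-- Along a run of entries without descents, the rows weakly decrease and the columns strictly
increase. -/
theorem IsStandard.row_le_and_col_lt {T : A.SSYT} (hT : T.IsStandard) {c d : A.cells}
    (h : T.entry c < T.entry d)
    (hdes : ∀ i, T.entry c < i → i ≤ T.entry d → i ∉ T.descents) :
    d.1.1 ≤ c.1.1 ∧ c.1.2 < d.1.2 := by
  have key : ∀ q, T.entry c + 1 ≤ q → ∀ d : A.cells, T.entry d = q →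
      (∀ i, T.entry c < i → i ≤ q → i ∉ T.descents) → d.1.1 ≤ c.1.1 ∧ c.1.2 < d.1.2 := by
    intro q hq
    induction q, hq using Nat.le_induction with
    | base =>
      intro d hd hdes
      have h1 := hdes (T.entry d) (by omega) (by omega)
      rw [hT.mem_descents_iff hd.symm] at h1
      exact ⟨not_lt.1 h1, (hT.col_lt_iff hd.symm).2 h1⟩
    | succ q hq ih =>
      intro d hd hdes
      obtain ⟨e, he⟩ := hT.exists_entry_eq (p := q) (by have := hT.lt_card d; omega)
      have h0 : T.entry e + 1 = T.entry d := by omega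
      have h1 := hdes (T.entry d) (by omega) (by omega)
      rw [hT.mem_descents_iff h0] at h1
      have h2 := (hT.col_lt_iff h0).2 h1
      have h3 := ih e he fun i hi hi' => hdes i hi (by omega)
      omega
  exact key _ h d rfl hdes

theorem notMem_breaks_of_blockIndex_eq {d : ℕ →₀ ℕ} {p q i : ℕ} (hq : q < d.degree)
    (h : d.blockIndex p = d.blockIndex q) (hi : p < i) (hi' : i ≤ q) : i ∉ d.breaks := by
  intro hb
  obtain ⟨-, t, ht⟩ := Finsupp.mem_breaks.1 hb
  have h1 := d.psum_blockIndex_le p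
  have h2 := Finsupp.lt_psum_blockIndex_succ hq
  rw [← h] at h2
  rcases Nat.lt_or_ge (d.blockIndex p) t with h3 | h3
  · have := d.psum_mono (Nat.succ_le_of_lt h3)
    simp only [Nat.succ_eq_add_one] at this
    omega
  · have := d.psum_mono h3
    omega

theorem IsStandard.row_le_and_col_lt_of_blockIndex_eq {T : A.SSYT} (hT : T.IsStandard) {d : ℕ →₀ ℕ}
    (hd : d.degree = A.cells.card) (hdes : T.descents ⊆ d.breaks) {c e : A.cells}
    (h : T.entry c < T.entry e) (hb : d.blockIndex (T.entry c) = d.blockIndex (T.entry e)) :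
    e.1.1 ≤ c.1.1 ∧ c.1.2 < e.1.2 :=
  hT.row_le_and_col_lt h fun _ hi hi' hm =>
    notMem_breaks_of_blockIndex_eq (by rw [hd]; exact hT.lt_card e) hb hi hi' (hdes hm)

/-- The semistandard tableau of content `d` whose standardization is `T`. -/
noncomputable def collapse (T : A.SSYT) (hT : T.IsStandard) (d : ℕ →₀ ℕ)
    (hd : d.degree = A.cells.card) (hdes : T.descents ⊆ d.breaks) : A.SSYT where
  entry c := d.blockIndex (T.entry c)
  row_weak c e h1 h2 := Finsupp.blockIndex_mono (T.row_weak c e h1 h2)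
    (by rw [hd]; exact hT.lt_card e)
  col_strict c e h1 h2 := by
    have hlt := T.col_strict c e h1 h2
    refine (Finsupp.blockIndex_mono hlt.le (by rw [hd]; exact hT.lt_card e)).lt_of_ne fun hb => ?_
    -- Entries in one block form a run without descents, along which rows never go down.
    exact h2.not_ge (hT.row_le_and_col_lt_of_blockIndex_eq hd hdes hlt hb).1

theorem collapse_content (T : A.SSYT) (hT : T.IsStandard) (d : ℕ →₀ ℕ)
    (hd : d.degree = A.cells.card) (hdes : T.descents ⊆ d.breaks) :
    (collapse T hT d hd hdes).content = d := by
  ext t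
  rw [content_apply]
  trans (Finset.Ico (d.psum t) (d.psum (t + 1))).card
  · have hiff : ∀ c, (collapse T hT d hd hdes).entry c = t ↔
        d.psum t ≤ T.entry c ∧ T.entry c < d.psum (t + 1) := fun c =>
      Finsupp.blockIndex_eq_iff (by rw [hd]; exact hT.lt_card c)
    refine Finset.card_bij (fun c _ => T.entry c) ?_ ?_ ?_
    · intro c hc
      simp only [Finset.mem_filter, Finset.mem_univ, true_and] at hc
      rwa [Finset.mem_Ico, ← hiff]
    · intro c _ e _ h
      exact hT.injective h
    · intro p hp
      rw [Finset.mem_Ico] at hp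
      obtain ⟨c, rfl⟩ := hT.exists_entry_eq
        (p := p) (by rw [← hd]; exact hp.2.trans_le (d.psum_le_degree _))
      refine ⟨c, ?_, rfl⟩
      simp only [Finset.mem_filter, Finset.mem_univ, true_and]
      exact (hiff c).2 hp
  · rw [Nat.card_Ico, Finsupp.psum_succ, Nat.add_sub_cancel_left]

/-- The order on boxes defining the standardization: by entry, then by column. -/
def readingKey (V : A.SSYT) (c : A.cells) : ℕ ×ₗ ℕ := toLex (V.entry c, c.1.2)

theorem readingKey_lt_iff {V : A.SSYT} {c e : A.cells} : V.readingKey c < V.readingKey e ↔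
    V.entry c < V.entry e ∨ V.entry c = V.entry e ∧ c.1.2 < e.1.2 :=
  Prod.Lex.toLex_lt_toLex

theorem readingKey_injective (V : A.SSYT) : Function.Injective V.readingKey := by
  intro c e h
  have h' := toLex.injective h
  exact V.eq_of_entry_eq_of_col_eq (Prod.ext_iff.1 h').1 (Prod.ext_iff.1 h').2

/-- Within a block the entries of `T` increase from left to right, so the order of `T` can be read
off from the collapsed tableau. -/
theorem IsStandard.lt_iff_readingKey_lt {T : A.SSYT} (hT : T.IsStandard) {d : ℕ →₀ ℕ}
    (hd : d.degree = A.cells.card) (hdes : T.descents ⊆ d.breaks) {c e : A.cells} :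
    T.entry c < T.entry e ↔
      (collapse T hT d hd hdes).readingKey c < (collapse T hT d hd hdes).readingKey e := by
  have key : ∀ {c e : A.cells}, T.entry c < T.entry e →
      (collapse T hT d hd hdes).readingKey c < (collapse T hT d hd hdes).readingKey e := by
    intro c e h
    rw [readingKey_lt_iff]
    rcases (Finsupp.blockIndex_mono (d := d) h.le
      (by rw [hd]; exact hT.lt_card e)).lt_or_eq with hb | hb
    · exact Or.inl hb
    · exact Or.inr ⟨hb, (hT.row_le_and_col_lt_of_blockIndex_eq hd hdes h hb).2⟩
  refine ⟨key, fun h => ?_⟩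
  by_contra! hle
  rcases hle.lt_or_eq with h' | h'
  · exact (h.trans (key h')).false
  · rw [hT.injective h'] at h
    exact h.false

theorem collapse_injective {T U : A.SSYT} (hT : T.IsStandard) (hU : U.IsStandard) {d : ℕ →₀ ℕ}
    (hd : d.degree = A.cells.card) (hTd : T.descents ⊆ d.breaks) (hUd : U.descents ⊆ d.breaks)
    (h : collapse T hT d hd hTd = collapse U hU d hd hUd) : T = U := by
  ext c
  rw [← hT.card_filter_lt, ← hU.card_filter_lt]
  congr 1
  ext e
  simp only [Finset.mem_filter, Finset.mem_univ, true_and]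
  rw [hT.lt_iff_readingKey_lt hd hTd, hU.lt_iff_readingKey_lt hd hUd, h]

theorem card_filter_readingKey_lt {V : A.SSYT} {c e : A.cells}
    (h : V.readingKey c < V.readingKey e) :
    (Finset.univ.filter fun x => V.readingKey x < V.readingKey c).card <
      (Finset.univ.filter fun x => V.readingKey x < V.readingKey e).card := by
  refine Finset.card_lt_card (Finset.ssubset_iff_of_subset ?_ |>.2 ⟨c, by simpa using h, by simp⟩)
  intro x hx
  simp only [Finset.mem_filter, Finset.mem_univ, true_and] at hx ⊢
  exact hx.trans h

/-- The standardization of a semistandard tableau. -/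
def standardize (V : A.SSYT) : A.SSYT where
  entry c := (Finset.univ.filter fun x => V.readingKey x < V.readingKey c).card
  row_weak c e h1 h2 := (card_filter_readingKey_lt (readingKey_lt_iff.2
    ((V.row_weak c e h1 h2).lt_or_eq.imp id fun h => ⟨h, h2⟩))).le
  col_strict c e h1 h2 :=
    card_filter_readingKey_lt (readingKey_lt_iff.2 (Or.inl (V.col_strict c e h1 h2)))

theorem standardize_lt_of_readingKey_lt {V : A.SSYT} {c e : A.cells}
    (h : V.readingKey c < V.readingKey e) : V.standardize.entry c < V.standardize.entry e :=
  card_filter_readingKey_lt h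

theorem readingKey_lt_of_standardize_lt {V : A.SSYT} {c e : A.cells}
    (h : V.standardize.entry c < V.standardize.entry e) : V.readingKey c < V.readingKey e := by
  by_contra! hle
  rcases hle.lt_or_eq with h' | h'
  · exact (h.trans (standardize_lt_of_readingKey_lt h')).false
  · rw [V.readingKey_injective h'] at h
    exact h.false

theorem standardize_isStandard (V : A.SSYT) : V.standardize.IsStandard where
  injective c e h := by
    rcases lt_trichotomy (V.readingKey c) (V.readingKey e) with h' | h' | h'
    · exact absurd h (standardize_lt_of_readingKey_lt h').ne
    · exact V.readingKey_injective h'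
    · exact absurd h (standardize_lt_of_readingKey_lt h').ne'
  lt_card c := by
    rw [← Fintype.card_coe A.cells, ← Finset.card_univ]
    exact Finset.card_lt_card (Finset.filter_ssubset.2 ⟨c, Finset.mem_univ c, lt_irrefl _⟩)

theorem card_filter_entry_lt (V : A.SSYT) (t : ℕ) :
    (Finset.univ.filter fun c => V.entry c < t).card = V.content.psum t := by
  rw [Finsupp.psum, Finset.card_eq_sum_card_fiberwise (f := V.entry) (t := Finset.range t)]
  · refine Finset.sum_congr rfl fun i hi => ?_
    rw [content_apply, Finset.filter_filter]
    congr 1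
    ext c
    simp only [Finset.mem_filter, Finset.mem_univ, true_and, and_iff_right_iff_imp]
    rintro rfl
    exact Finset.mem_range.1 hi
  · intro c hc
    simpa using hc

theorem psum_entry_le_standardize (V : A.SSYT) (c : A.cells) :
    V.content.psum (V.entry c) ≤ V.standardize.entry c := by
  rw [← card_filter_entry_lt]
  refine Finset.card_le_card fun x hx => ?_
  simp only [Finset.mem_filter, Finset.mem_univ, true_and] at hx ⊢
  exact readingKey_lt_iff.2 (Or.inl hx)

theorem standardize_lt_psum (V : A.SSYT) (c : A.cells) :
    V.standardize.entry c < V.content.psum (V.entry c + 1) := by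
  rw [← card_filter_entry_lt]
  refine Finset.card_lt_card (Finset.ssubset_iff_of_subset ?_ |>.2 ⟨c, by simp, by simp⟩)
  intro x hx
  simp only [Finset.mem_filter, Finset.mem_univ, true_and, readingKey_lt_iff] at hx ⊢
  omega

/-- At a descent the value in `V` must increase: two boxes of equal value would be ordered by
column, and the second would lie below and to the right of the first. The descent is then squeezed
onto a partial sum of the content. -/
theorem descents_standardize_subset (V : A.SSYT) : V.standardize.descents ⊆ V.content.breaks := by
  intro i hi
  simp only [descents, Finset.mem_filter, Finset.mem_Ioo] at hi
  obtain ⟨hin, c, e, hc, he, hrow⟩ := hi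
  rw [Finsupp.mem_breaks, content_degree]
  refine ⟨hin, V.entry e, ?_⟩
  have hk := readingKey_lt_of_standardize_lt (V := V) (c := c) (e := e) (by omega)
  have h1 := V.psum_entry_le_standardize e
  have h2 := V.standardize_lt_psum c
  rcases readingKey_lt_iff.1 hk with h | ⟨h, hcol⟩
  · have := V.content.psum_mono (Nat.succ_le_of_lt h)
    simp only [Nat.succ_eq_add_one] at this
    omega
  · exact absurd h (V.entry_lt_of_le (Prod.mk_le_mk.2 ⟨hrow.le, hcol.le⟩) hrow).ne

theorem collapse_standardize (V : A.SSYT) :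
    collapse V.standardize V.standardize_isStandard V.content V.content_degree
      V.descents_standardize_subset = V := by
  ext c
  refine (Finsupp.blockIndex_eq_iff ?_).2 ⟨V.psum_entry_le_standardize c, V.standardize_lt_psum c⟩
  rw [content_degree]
  exact V.standardize_isStandard.lt_card c

instance finite_isStandard : Finite {T : A.SSYT // T.IsStandard} := by
  let f : {T : A.SSYT // T.IsStandard} → A.cells → Fin A.cells.card := fun T c =>
    ⟨T.1.entry c, T.2.lt_card c⟩
  refine Finite.of_injective f fun T U h => Subtype.ext (ext fun c => ?_)
  exact congrArg Fin.val (congrFun h c)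

end SSYT

/-- The number of standard tableaux of shape `A` with descent set `S`, if `A` has `n` boxes. -/
noncomputable def descentCount (A : SkewShape) (n : ℕ) (S : Finset ℕ) : ℕ :=
  if A.cells.card = n then
    Nat.card {T : {T : A.SSYT // T.IsStandard} // T.1.descents = S} else 0

/-- Standardizing and collapsing are inverse bijections between tableaux of content `d` and standard
tableaux whose descents are among the breaks of `d`. -/
theorem card_content_eq_sum_descentCount (A : SkewShape) (d : ℕ →₀ ℕ) :
    Nat.card {T : A.SSYT // T.content = d} =
      ∑ S ∈ d.breaks.powerset, A.descentCount d.degree S := by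
  by_cases hd : d.degree = A.cells.card
  · simp only [descentCount, if_pos hd.symm]
    have h1 : Nat.card {T : A.SSYT // T.content = d} =
        Nat.card {T : {T : A.SSYT // T.IsStandard} // T.1.descents ⊆ d.breaks} := by
      symm
      refine Nat.card_eq_of_bijective
        (fun T => ⟨T.1.1.collapse T.1.2 d hd T.2, SSYT.collapse_content _ _ _ _ _⟩)
        ⟨fun T U h => ?_, fun V => ?_⟩
      · exact Subtype.ext (Subtype.ext (SSYT.collapse_injective T.1.2 U.1.2 hd T.2 U.2
          (congrArg Subtype.val h)))
      · obtain ⟨V, rfl⟩ := V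
        exact ⟨⟨⟨V.standardize, V.standardize_isStandard⟩, V.descents_standardize_subset⟩,
          Subtype.ext V.collapse_standardize⟩
    rw [h1]
    classical
    have := Fintype.ofFinite {T : A.SSYT // T.IsStandard}
    rw [Nat.card_eq_fintype_card, Fintype.card_subtype, Finset.card_eq_sum_card_fiberwise
      (f := fun T => T.1.descents) (t := d.breaks.powerset)]
    · refine Finset.sum_congr rfl fun S hS => ?_
      rw [Nat.card_eq_fintype_card, Fintype.card_subtype, Finset.filter_filter]
      congr 1
      ext T
      simp only [Finset.mem_filter, Finset.mem_univ, true_and, and_iff_right_iff_imp]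
      rintro rfl
      exact Finset.mem_powerset.1 hS
    · intro T hT
      simpa using hT
  · simp only [descentCount, if_neg (Ne.symm hd), Finset.sum_const_zero]
    rw [Nat.card_eq_zero]
    exact Or.inl ⟨fun T => hd (by rw [← T.2, T.1.content_degree])⟩

/-- The tableau with rows and columns exchanged, of a shape `B` that is the transpose of `A`. -/
def SSYT.transposeTo {A B : SkewShape} (hAB : ∀ c ∈ B.cells, c.swap ∈ A.cells) (T : A.SSYT)
    (hT : T.IsStandard) : B.SSYT where
  entry c := T.entry ⟨c.1.swap, hAB _ c.2⟩
  row_weak c e h1 h2 := (T.col_strict _ _ (by simpa using h1) (by simpa using h2)).le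
  col_strict c e h1 h2 := (T.row_weak ⟨c.1.swap, hAB _ c.2⟩ ⟨e.1.swap, hAB _ e.2⟩
    (by simpa using h1) (by simpa using h2)).lt_of_ne fun h => by
      have h3 := congrArg (fun x : A.cells => x.1.2) (hT.injective h)
      simp only [Prod.snd_swap] at h3
      omega

theorem SSYT.transposeTo_isStandard {A B : SkewShape} (hAB : ∀ c ∈ B.cells, c.swap ∈ A.cells)
    (hcard : A.cells.card = B.cells.card) (T : A.SSYT) (hT : T.IsStandard) :
    (transposeTo hAB T hT).IsStandard where
  injective c e h := Subtype.ext (Prod.swap_injective (congrArg Subtype.val (hT.injective h)))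
  lt_card c := by
    rw [← hcard]
    exact hT.lt_card _

/-- Of two consecutive entries the second lies either in a lower row or in a later column, never
both; swapping coordinates exchanges the alternatives. -/
theorem SSYT.descents_transposeTo {A B : SkewShape} (hAB : ∀ c ∈ B.cells, c.swap ∈ A.cells)
    (hcard : A.cells.card = B.cells.card) (T : A.SSYT) (hT : T.IsStandard) :
    (transposeTo hAB T hT).descents = Finset.Ioo 0 A.cells.card \ T.descents := by
  ext i
  have hU := transposeTo_isStandard hAB hcard T hT
  by_cases hi : i ∈ Finset.Ioo 0 A.cells.card
  · rw [Finset.mem_sdiff, and_iff_right hi]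
    rw [Finset.mem_Ioo] at hi
    obtain ⟨c, hc⟩ := hU.exists_entry_eq (p := i - 1) (by omega)
    obtain ⟨e, he⟩ := hU.exists_entry_eq (p := i) (by omega)
    have h1 : (transposeTo hAB T hT).entry c + 1 = (transposeTo hAB T hT).entry e := by omega
    have h2 : T.entry ⟨c.1.swap, hAB _ c.2⟩ + 1 = T.entry ⟨e.1.swap, hAB _ e.2⟩ := h1
    have h3 := hU.mem_descents_iff h1
    have h4 := hT.mem_descents_iff h2
    have h5 := hT.col_lt_iff h2
    rw [he] at h3
    rw [show T.entry ⟨e.1.swap, hAB _ e.2⟩ = i from he] at h4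
    rw [h3, h4, ← h5]
    rfl
  · refine iff_of_false (fun h => hi ?_) fun h => hi (Finset.mem_sdiff.1 h).1
    rw [hcard]
    exact descents_subset _ h

theorem descentCount_transpose (A : SkewShape) {n : ℕ} {S : Finset ℕ}
    (hS : S ⊆ Finset.Ioo 0 n) :
    A.transpose.descentCount n S = A.descentCount n (Finset.Ioo 0 n \ S) := by
  unfold descentCount
  rw [card_transpose_cells]
  split_ifs with hn
  -- Stating the transposition through membership lets one map serve both directions without a cast,
  -- and both round trips hold by `rfl`.
  · have h1 : ∀ c ∈ A.transpose.cells, c.swap ∈ A.cells := fun c hc => mem_transpose_cells.1 hc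
    have h2 : ∀ c ∈ A.cells, c.swap ∈ A.transpose.cells := fun c hc =>
      mem_transpose_cells.2 (by simpa using hc)
    have hcard := A.card_transpose_cells
    refine Nat.card_congr ⟨
      fun T => ⟨⟨SSYT.transposeTo h2 T.1.1 T.1.2, SSYT.transposeTo_isStandard h2 hcard _ _⟩, ?_⟩,
      fun T => ⟨⟨SSYT.transposeTo h1 T.1.1 T.1.2, SSYT.transposeTo_isStandard h1 hcard.symm _ _⟩,
        ?_⟩, fun T => ?_, fun T => ?_⟩
    · rw [SSYT.descents_transposeTo h2 hcard, T.2, hcard, hn]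
    · rw [SSYT.descents_transposeTo h1 hcard.symm, T.2, hn, Finset.sdiff_sdiff_eq_self hS]
    · rfl
    · rfl
  · rfl

end SkewShape

theorem coeff_skewSchur_eq_sum (A : SkewShape) (d : ℕ →₀ ℕ) :
    MvPowerSeries.coeff d (skewSchur A) =
      ∑ S ∈ d.breaks.powerset, (A.descentCount d.degree S : ℚ) := by
  rw [coeff_skewSchur, SkewShape.card_content_eq_sum_descentCount, Nat.cast_sum]

/-- A function on the subsets of `U` is determined by its sums over all power sets. -/
theorem Finset.eq_of_sum_powerset_eq {U : Finset ℕ} {f g : Finset ℕ → ℚ}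
    (h : ∀ X ⊆ U, ∑ S ∈ X.powerset, f S = ∑ S ∈ X.powerset, g S) {X : Finset ℕ} (hX : X ⊆ U) :
    f X = g X := by
  induction X using Finset.strongInduction with
  | _ X ih =>
    have h1 := h X hX
    rw [← Finset.add_sum_erase _ f (Finset.mem_powerset_self X),
      ← Finset.add_sum_erase _ g (Finset.mem_powerset_self X)] at h1
    rw [Finset.sum_congr rfl fun S hS => ?_] at h1
    · exact add_right_cancel h1
    · rw [Finset.mem_erase, Finset.mem_powerset] at hS
      exact ih S (hS.2.ssubset_of_ne hS.1) (hS.2.trans hX)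

/-! ### Compositions, exponent vectors, and the expansion into fundamental quasisymmetric functions.
-/

namespace Composition

variable {n : ℕ}

theorem mem_partialSums {α : Composition n} {x : ℕ} :
    x ∈ α.partialSums ↔ (0 < x ∧ x < n) ∧ ∃ k ≤ α.length, α.sizeUpTo k = x := by
  simp only [partialSums, Finset.mem_image, Finset.mem_Ico]
  constructor
  · rintro ⟨k, ⟨h1, h2⟩, rfl⟩
    refine ⟨⟨?_, ?_⟩, k, h2.le, rfl⟩
    · have h3 := α.sizeUpTo_strict_mono (i := 0) (by omega)
      have h4 := α.monotone_sizeUpTo h1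
      rw [α.sizeUpTo_zero] at h3
      simp only [zero_add] at h3
      omega
    · have h3 := α.sizeUpTo_strict_mono h2
      have h4 := α.sizeUpTo_le (k + 1)
      omega
  · rintro ⟨⟨h1, h2⟩, k, hk, rfl⟩
    refine ⟨k, ⟨?_, ?_⟩, rfl⟩
    · rcases Nat.eq_zero_or_pos k with rfl | h
      · rw [α.sizeUpTo_zero] at h1
        omega
      · exact h
    · refine hk.lt_of_ne ?_
      rintro rfl
      rw [α.sizeUpTo_length] at h2
      omega

theorem mem_boundaries {α : Composition n} {b : Fin (n + 1)} :
    b ∈ α.boundaries ↔ ∃ k ≤ α.length, α.sizeUpTo k = b := by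
  simp only [boundaries, Finset.mem_map, Finset.mem_univ, true_and]
  constructor
  · rintro ⟨k, rfl⟩
    exact ⟨k, Nat.le_of_lt_succ k.2, rfl⟩
  · rintro ⟨k, hk, h⟩
    exact ⟨⟨k, Nat.lt_succ_of_le hk⟩, Fin.ext h⟩

theorem mem_boundaries_iff_partialSums {α : Composition n} {b : Fin (n + 1)} :
    b ∈ α.boundaries ↔ (b : ℕ) = 0 ∨ (b : ℕ) = n ∨ (b : ℕ) ∈ α.partialSums := by
  rw [mem_boundaries, mem_partialSums]
  constructor
  · intro h
    have := b.2
    by_cases h0 : (b : ℕ) = 0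
    · exact Or.inl h0
    by_cases hn : (b : ℕ) = n
    · exact Or.inr (Or.inl hn)
    exact Or.inr (Or.inr ⟨by omega, h⟩)
  · rintro (h | h | h)
    · exact ⟨0, Nat.zero_le _, by rw [α.sizeUpTo_zero, h]⟩
    · exact ⟨α.length, le_rfl, by rw [α.sizeUpTo_length, h]⟩
    · exact h.2

theorem partialSums_injective : Function.Injective (partialSums (n := n)) := by
  intro α β h
  apply (compositionEquiv n).injective
  apply CompositionAsSet.ext
  change α.boundaries = β.boundaries
  ext b
  rw [mem_boundaries_iff_partialSums, mem_boundaries_iff_partialSums, h]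

theorem partialSums_subset (α : Composition n) : α.partialSums ⊆ Finset.Ioo 0 n :=
  fun _ hx => Finset.mem_Ioo.2 (mem_partialSums.1 hx).1

theorem exists_partialSums_eq {S : Finset ℕ} (hS : S ⊆ Finset.Ioo 0 n) :
    ∃ α : Composition n, α.partialSums = S := by
  classical
  let s : CompositionAsSet n :=
    { boundaries := Finset.univ.filter fun b : Fin (n + 1) =>
        (b : ℕ) = 0 ∨ (b : ℕ) = n ∨ (b : ℕ) ∈ S
      zero_mem := by simp
      getLast_mem := by simp }
  refine ⟨s.toComposition, ?_⟩
  have hb : ∀ b : Fin (n + 1), b ∈ s.toComposition.boundaries ↔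
      (b : ℕ) = 0 ∨ (b : ℕ) = n ∨ (b : ℕ) ∈ S := fun b => by
    rw [s.toComposition_boundaries]
    simp [s]
  ext x
  by_cases hx : 0 < x ∧ x < n
  · have h1 := hb ⟨x, by omega⟩
    rw [mem_boundaries_iff_partialSums] at h1
    simp only at h1
    have : x ≠ 0 := by omega
    have : x ≠ n := by omega
    tauto
  · refine iff_of_false (fun h => hx ?_) fun h => hx ?_
    · exact (mem_partialSums.1 h).1
    · exact Finset.mem_Ioo.1 (hS h)

theorem sum_blocksFun_lt (α : Composition n) {k : ℕ} (hk : k ≤ α.length) :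
    ∑ j ∈ Finset.univ.filter fun j : Fin α.length => (j : ℕ) < k, α.blocksFun j = α.sizeUpTo k := by
  induction k with
  | zero => simp
  | succ k ih =>
    have hlt : k < α.length := hk
    rw [α.sizeUpTo_succ hlt, ← ih hlt.le]
    have : (Finset.univ.filter fun j : Fin α.length => (j : ℕ) < k + 1) =
        insert ⟨k, hlt⟩ (Finset.univ.filter fun j : Fin α.length => (j : ℕ) < k) := by
      ext j
      simp only [Finset.mem_filter, Finset.mem_univ, true_and, Finset.mem_insert, Fin.ext_iff]
      omega
    rw [this, Finset.sum_insert (by simp), add_comm]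
    rfl

/-- The exponent vector `x_{i₁}^{α₁} ⋯ x_{i_k}^{α_k}`. -/
noncomputable def exponent (α : Composition n) (i : Fin α.length ↪o ℕ) : ℕ →₀ ℕ :=
  ∑ j, Finsupp.single (i j) (α.blocksFun j)

theorem exponent_degree (α : Composition n) (i : Fin α.length ↪o ℕ) :
    (α.exponent i).degree = n := by
  rw [exponent, map_sum]
  simp only [Finsupp.degree_single]
  exact α.sum_blocksFun

theorem exponent_apply (α : Composition n) (i : Fin α.length ↪o ℕ) (t : ℕ) :
    α.exponent i t = ∑ j with i j = t, α.blocksFun j := by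
  rw [exponent, Finsupp.finsetSum_apply, Finset.sum_filter]
  exact Finset.sum_congr rfl fun j _ => by rw [Finsupp.single_apply]

theorem exponent_support (α : Composition n) (i : Fin α.length ↪o ℕ) :
    ((α.exponent i).support : Set ℕ) = Set.range i := by
  ext t
  rw [Finset.mem_coe, Finsupp.mem_support_iff, exponent_apply, ne_eq, Finset.sum_eq_zero_iff]
  simp only [Finset.mem_filter, Finset.mem_univ, true_and, Set.mem_range, not_forall]
  constructor
  · rintro ⟨j, h, -⟩
    exact ⟨j, h⟩
  · rintro ⟨j, h⟩
    exact ⟨j, h, Nat.one_le_iff_ne_zero.1 (α.one_le_blocksFun j)⟩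

theorem exponent_injective (α : Composition n) : Function.Injective α.exponent := by
  intro i i' h
  have h1 := congrArg (fun d : ℕ →₀ ℕ => (d.support : Set ℕ)) h
  simp only [exponent_support] at h1
  exact OrderEmbedding.range_inj.1 h1

theorem psum_exponent (α : Composition n) (i : Fin α.length ↪o ℕ) (t : ℕ) :
    (α.exponent i).psum t = ∑ j with i j < t, α.blocksFun j := by
  rw [Finsupp.psum]
  simp only [exponent_apply, Finset.sum_filter]
  rw [Finset.sum_comm]
  refine Finset.sum_congr rfl fun j _ => ?_
  simp

theorem exists_psum_exponent_eq (α : Composition n) (i : Fin α.length ↪o ℕ) (t : ℕ) :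
    ∃ k ≤ α.length, (α.exponent i).psum t = α.sizeUpTo k := by
  classical
  -- The witness is the number of parts placed at variables before `t`: the first index reaching
  -- `t`, or all of them.
  by_cases h : ∃ k, ∃ hk : k < α.length, t ≤ i ⟨k, hk⟩
  · obtain ⟨hk, ht⟩ := Nat.find_spec h
    refine ⟨Nat.find h, hk.le, ?_⟩
    rw [psum_exponent, ← α.sum_blocksFun_lt hk.le]
    refine Finset.sum_congr (Finset.filter_congr fun j _ => ?_) fun _ _ => rfl
    constructor
    · intro hj
      by_contra! hle
      have : i ⟨Nat.find h, hk⟩ ≤ i j := i.monotone (Fin.mk_le_of_le_val hle)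
      omega
    · intro hj
      by_contra! hle
      exact Nat.find_min h hj ⟨j.2, hle⟩
  · push Not at h
    refine ⟨α.length, le_rfl, ?_⟩
    rw [psum_exponent, ← α.sum_blocksFun_lt le_rfl]
    refine Finset.sum_congr (Finset.filter_congr fun j _ => ?_) fun _ _ => rfl
    exact iff_of_true (h j j.2) j.2

/-- Skipped variables have exponent zero and create no new partial sums, so the choice of variables
does not affect the breaks. -/
theorem breaks_exponent (α : Composition n) (i : Fin α.length ↪o ℕ) :
    (α.exponent i).breaks = α.partialSums := by
  ext x
  rw [Finsupp.mem_breaks, exponent_degree, mem_partialSums, and_congr_right_iff]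
  rintro ⟨h0, hn⟩
  constructor
  · rintro ⟨t, rfl⟩
    obtain ⟨k, hk, h⟩ := α.exists_psum_exponent_eq i t
    exact ⟨k, hk, h.symm⟩
  · rintro ⟨k, hk, rfl⟩
    have hlt : k < α.length := hk.lt_of_ne (by
      rintro rfl
      rw [α.sizeUpTo_length] at hn
      omega)
    refine ⟨i ⟨k, hlt⟩, ?_⟩
    rw [psum_exponent, ← α.sum_blocksFun_lt hk]
    refine Finset.sum_congr (Finset.filter_congr fun j _ => ?_) fun _ _ => rfl
    rw [i.lt_iff_lt, Fin.lt_def]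

theorem exists_exponent_eq {d : ℕ →₀ ℕ} (hd : d.degree = n) :
    ∃ (α : Composition n) (i : Fin α.length ↪o ℕ), α.exponent i = d := by
  let e := d.support.orderEmbOfFin rfl
  let α : Composition n :=
    { blocks := List.ofFn fun j => d (e j)
      blocks_pos := by
        intro x hx
        obtain ⟨j, rfl⟩ := (List.mem_ofFn' _ _).1 hx
        exact Nat.pos_of_ne_zero
          (Finsupp.mem_support_iff.1 (d.support.orderEmbOfFin_mem rfl j))
      blocks_sum := by
        rw [List.sum_ofFn, ← hd, Finsupp.degree_apply,
          ← Finset.sum_coe_sort d.support, ← (d.support.orderIsoOfFin rfl).toEquiv.sum_comp]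
        rfl }
  have hlen : α.length = d.support.card := List.length_ofFn
  refine ⟨α, (Fin.castOrderIso hlen).toOrderEmbedding.trans e, ?_⟩
  have hb : ∀ j : Fin α.length, α.blocksFun j = d (e (Fin.cast hlen j)) := fun j => by
    simp only [blocksFun, α, List.get_eq_getElem, List.getElem_ofFn]
    rfl
  rw [exponent]
  simp only [hb]
  trans ∑ j : Fin d.support.card, Finsupp.single (e j) (d (e j))
  · exact (finCongr hlen).sum_comp fun j => Finsupp.single (e j) (d (e j))
  · conv_rhs => rw [← Finsupp.sum_single d]
    rw [Finsupp.sum, ← Finset.sum_coe_sort d.support,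
      ← (d.support.orderIsoOfFin rfl).toEquiv.sum_comp]
    rfl

theorem exists_partialSums_eq_breaks {d : ℕ →₀ ℕ} (hd : d.degree = n) :
    ∃ α : Composition n, α.partialSums = d.breaks := by
  obtain ⟨α, i, rfl⟩ := exists_exponent_eq hd
  exact ⟨α, (α.breaks_exponent i).symm⟩

end Composition

theorem Finsupp.exists_breaks_eq {n : ℕ} {S : Finset ℕ} (hS : S ⊆ Finset.Ioo 0 n) :
    ∃ d : ℕ →₀ ℕ, d.degree = n ∧ d.breaks = S := by
  obtain ⟨α, rfl⟩ := Composition.exists_partialSums_eq hS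
  exact ⟨α.exponent (Fin.valOrderEmb _), α.exponent_degree _, α.breaks_exponent _⟩

/-- The support of an exponent vector gives its variables, and its degree and breaks give the
composition, so each monomial occurs at most once. -/
theorem coeff_monomialQSym {n : ℕ} (α : Composition n) (d : ℕ →₀ ℕ) :
    MvPowerSeries.coeff d (monomialQSym α) =
      if d.degree = n ∧ α.partialSums = d.breaks then 1 else 0 := by
  change (Nat.card {i // α.exponent i = d} : ℚ) = _
  split_ifs with h
  · obtain ⟨β, i, hi⟩ := Composition.exists_exponent_eq h.1
    obtain rfl : α = β := Composition.partialSums_injective (by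
      rw [h.2, ← hi, β.breaks_exponent])
    rw [Nat.cast_eq_one, Nat.card_eq_one_iff_unique]
    exact ⟨⟨fun x y => Subtype.ext (α.exponent_injective (x.2.trans y.2.symm))⟩, ⟨⟨i, hi⟩⟩⟩
  · rw [Nat.cast_eq_zero, Nat.card_eq_zero]
    refine Or.inl ⟨fun i => h ?_⟩
    rw [← i.2, α.exponent_degree, α.breaks_exponent]
    exact ⟨rfl, rfl⟩

theorem coeff_fundamentalQSym (α : Σ n, Composition n) (d : ℕ →₀ ℕ) :
    MvPowerSeries.coeff d (fundamentalQSym α) =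
      if d.degree = α.1 ∧ α.2.partialSums ⊆ d.breaks then 1 else 0 := by
  rw [fundamentalQSym, map_sum]
  simp only [coeff_monomialQSym]
  by_cases hd : d.degree = α.1
  · obtain ⟨β, hβ⟩ := Composition.exists_partialSums_eq_breaks hd
    simp only [hd, true_and, ← hβ, Composition.partialSums_injective.eq_iff]
    rw [Finset.sum_ite_eq']
    simp
  · simp [hd]

/-- The coefficients in an expansion of a skew Schur function into fundamental quasisymmetric
functions count standard tableaux by descent set. -/
theorem fundamentalQSym_coeff_eq {A : SkewShape} {c : (Σ n, Composition n) →₀ ℚ}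
    (hc : Finsupp.linearCombination ℚ fundamentalQSym c = skewSchur A) (α : Σ n, Composition n) :
    c α = A.descentCount α.1 α.2.partialSums := by
  classical
  -- Every `X` is the set of breaks of some `d`; both sums over its power set are then the
  -- coefficient of `x^d` in `s_A`.
  have key := Finset.eq_of_sum_powerset_eq (U := Finset.Ioo 0 α.1)
    (f := fun S => ∑ β ∈ c.support, if β.1 = α.1 ∧ β.2.partialSums = S then c β else 0)
    (g := fun S => (A.descentCount α.1 S : ℚ)) (fun X hX => by
      obtain ⟨d, hd, rfl⟩ := Finsupp.exists_breaks_eq hX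
      rw [← hd, ← coeff_skewSchur_eq_sum, ← hc, Finsupp.linearCombination_apply, Finsupp.sum,
        map_sum, Finset.sum_comm]
      refine Finset.sum_congr rfl fun β _ => ?_
      rw [map_smul, coeff_fundamentalQSym]
      by_cases hβ : d.degree = β.1
      · simp [hβ, Finset.sum_ite_eq]
      · simp [hβ, Ne.symm hβ]) α.2.partialSums_subset
  rw [← key, Finset.sum_eq_single α]
  · simp
  · rintro ⟨n, β⟩ - hne
    rw [if_neg]
    rintro ⟨h1, h2⟩
    obtain ⟨m, α⟩ := α
    simp only at h1
    subst h1
    exact hne (congrArg _ (Composition.partialSums_injective h2))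
  · intro h
    simp [Finsupp.notMem_support_iff.1 h]

theorem exists_linearCombination_fundamentalQSym_eq_skewSchur (A : SkewShape) :
    ∃ c : (Σ n, Composition n) →₀ ℚ,
      Finsupp.linearCombination ℚ fundamentalQSym c = skewSchur A := by
  refine ⟨∑ α : Composition A.cells.card,
    Finsupp.single ⟨_, α⟩ (A.descentCount A.cells.card α.partialSums : ℚ), ?_⟩
  ext d
  rw [map_sum, map_sum, coeff_skewSchur_eq_sum]
  simp only [Finsupp.linearCombination_single, map_smul, coeff_fundamentalQSym, smul_eq_mul,
    mul_ite, mul_one, mul_zero]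
  by_cases hd : d.degree = A.cells.card
  · simp only [hd, true_and]
    rw [← Finset.sum_filter]
    refine Finset.sum_bij (fun α _ => α.partialSums) ?_ ?_ ?_ ?_
    · intro α hα
      simpa using hα
    · intro α _ β _ h
      exact Composition.partialSums_injective h
    · intro S hS
      rw [Finset.mem_powerset] at hS
      obtain ⟨α, rfl⟩ := Composition.exists_partialSums_eq (n := A.cells.card)
        (hS.trans (by rw [← hd]; exact d.breaks_subset))
      exact ⟨α, by simpa using hS, rfl⟩
    · intro α _
      rfl
  · simp [hd, SkewShape.descentCount, Ne.symm hd]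

theorem mem_fundamentalSupport_iff {A : SkewShape} {α : Σ n, Composition n} :
    α ∈ fundamentalSupport A ↔ 0 < A.descentCount α.1 α.2.partialSums := by
  constructor
  · rintro ⟨c, hc, h⟩
    rw [fundamentalQSym_coeff_eq hc] at h
    exact_mod_cast h
  · intro h
    obtain ⟨c, hc⟩ := exists_linearCombination_fundamentalQSym_eq_skewSchur A
    refine ⟨c, hc, ?_⟩
    rw [fundamentalQSym_coeff_eq hc]
    exact_mod_cast h

/-! ### Descent sets under `shrink` and `transpose`. -/

theorem Finsupp.psum_natCons_succ (m : ℕ) (d : ℕ →₀ ℕ) (t : ℕ) :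
    (Finsupp.natCons m d).psum (t + 1) = m + d.psum t := by
  simp [psum, Finset.sum_range_succ', add_comm]

theorem Finsupp.mem_breaks_natCons {m : ℕ} {d : ℕ →₀ ℕ} {x : ℕ} :
    x ∈ (Finsupp.natCons m d).breaks ↔
      (0 < x ∧ x < m + d.degree) ∧ (x = m ∨ m < x ∧ x - m ∈ d.breaks) := by
  simp only [mem_breaks, natCons_degree, and_congr_right_iff]
  rintro ⟨h0, hx⟩
  constructor
  · rintro ⟨t, ht⟩
    cases t with
    | zero => rw [psum_zero] at ht; omega
    | succ t =>
      rw [psum_natCons_succ] at ht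
      rcases Nat.eq_zero_or_pos (d.psum t) with h | h
      · exact Or.inl (by omega)
      · exact Or.inr ⟨by omega, ⟨by omega, by omega⟩, t, by omega⟩
  · rintro (h | ⟨h, -, t, ht⟩)
    · exact ⟨1, by rw [psum_natCons_succ, psum_zero, h, add_zero]⟩
    · exact ⟨t + 1, by rw [psum_natCons_succ]; omega⟩

/-- The elements of `Q` beyond `m`, decreased by `m`. -/
def Finset.shiftDown (m : ℕ) (Q : Finset ℕ) : Finset ℕ := (Q.filter (m < ·)).image (· - m)

theorem Finset.mem_shiftDown {m x : ℕ} {Q : Finset ℕ} :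
    x ∈ Q.shiftDown m ↔ 0 < x ∧ m + x ∈ Q := by
  simp only [shiftDown, Finset.mem_image, Finset.mem_filter]
  constructor
  · rintro ⟨q, ⟨hq, hm⟩, rfl⟩
    exact ⟨by omega, by rwa [Nat.add_sub_cancel' hm.le]⟩
  · rintro ⟨h1, h2⟩
    exact ⟨m + x, ⟨h2, by omega⟩, by omega⟩

/-- The descent sets of size `m + n` that have no descent before `m` and that restrict to `S`
beyond `m`. -/
def descentExtensions (m n : ℕ) (S : Finset ℕ) : Finset (Finset ℕ) :=
  (Finset.Ioo 0 (m + n)).powerset.filter fun Q => (∀ q ∈ Q, m ≤ q) ∧ Q.shiftDown m = S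

theorem mem_descentExtensions_iff {m : ℕ} {d : ℕ →₀ ℕ} {S Q : Finset ℕ} (hS : S ⊆ d.breaks) :
    Q ∈ descentExtensions m d.degree S ↔
      Q ⊆ (Finsupp.natCons m d).breaks ∧ Q.shiftDown m = S := by
  simp only [descentExtensions, Finset.mem_filter, Finset.mem_powerset]
  constructor
  · rintro ⟨h1, h2, rfl⟩
    refine ⟨fun q hq => ?_, rfl⟩
    rw [Finsupp.mem_breaks_natCons]
    refine ⟨Finset.mem_Ioo.1 (h1 hq), ?_⟩
    rcases (h2 q hq).eq_or_lt with h | h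
    · exact Or.inl h.symm
    · refine Or.inr ⟨h, hS (Finset.mem_shiftDown.2 ⟨by omega, ?_⟩)⟩
      rwa [Nat.add_sub_cancel' h.le]
  · rintro ⟨h1, h2⟩
    refine ⟨fun q hq => ?_, fun q hq => ?_, h2⟩
    · exact Finset.mem_Ioo.2 (Finsupp.mem_breaks_natCons.1 (h1 hq)).1
    · have := (Finsupp.mem_breaks_natCons.1 (h1 hq)).2
      omega

theorem shiftDown_subset_breaks {m : ℕ} {d : ℕ →₀ ℕ} {Q : Finset ℕ}
    (hQ : Q ⊆ (Finsupp.natCons m d).breaks) : Q.shiftDown m ⊆ d.breaks := by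
  intro x hx
  obtain ⟨h0, hx⟩ := Finset.mem_shiftDown.1 hx
  rcases (Finsupp.mem_breaks_natCons.1 (hQ hx)).2 with h | ⟨-, h⟩
  · omega
  · rwa [Nat.add_sub_cancel_left] at h

/-- The head coefficient of `s_A` is expanded by descent sets, which are grouped by their part
beyond `numCols`. Since the terms are nonnegative, the left side is positive exactly when some term
is. -/
theorem descentCount_shrink (A : SkewShape) {n : ℕ} {S : Finset ℕ} (hS : S ⊆ Finset.Ioo 0 n) :
    (A.shrink.descentCount n S : ℚ) =
      ∑ Q ∈ descentExtensions A.numCols n S, (A.descentCount (A.numCols + n) Q : ℚ) := by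
  refine Finset.eq_of_sum_powerset_eq (U := Finset.Ioo 0 n)
    (f := fun S => (A.shrink.descentCount n S : ℚ))
    (g := fun S => ∑ Q ∈ descentExtensions A.numCols n S,
      (A.descentCount (A.numCols + n) Q : ℚ)) (fun X hX => ?_) hS
  obtain ⟨d, rfl, rfl⟩ := Finsupp.exists_breaks_eq hX
  rw [← coeff_skewSchur_eq_sum, ← headCoeff_skewSchur, coeff_headCoeff, coeff_skewSchur_eq_sum,
    Finsupp.natCons_degree, ← Finset.sum_fiberwise_of_maps_to (t := d.breaks.powerset)
      (g := Finset.shiftDown A.numCols) (fun Q hQ => ?_)]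
  · refine Finset.sum_congr rfl fun S hS => Finset.sum_congr ?_ fun _ _ => rfl
    ext Q
    rw [mem_descentExtensions_iff (Finset.mem_powerset.1 hS), Finset.mem_filter,
      Finset.mem_powerset]
  · exact Finset.mem_powerset.2 (shiftDown_subset_breaks (Finset.mem_powerset.1 hQ))

namespace SkewShape

/-- The standard tableaux of the two shapes have the same descent sets. -/
def SameDescents (A B : SkewShape) : Prop :=
  ∀ (n : ℕ) (S : Finset ℕ), S ⊆ Finset.Ioo 0 n →
    (0 < A.descentCount n S ↔ 0 < B.descentCount n S)

namespace SameDescents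

variable {A B : SkewShape}

theorem symm (h : SameDescents A B) : SameDescents B A := fun n S hS => (h n S hS).symm

theorem card_eq (h : SameDescents A B) : A.cells.card = B.cells.card := by
  obtain ⟨V⟩ := (inferInstance : Nonempty A.SSYT)
  have hA : 0 < A.descentCount A.cells.card V.standardize.descents := by
    rw [descentCount, if_pos rfl, Nat.card_pos_iff]
    exact ⟨⟨⟨⟨_, V.standardize_isStandard⟩, rfl⟩⟩, inferInstance⟩
  rw [h _ _ (SSYT.descents_subset _), descentCount] at hA
  by_contra hne
  rw [if_neg (Ne.symm hne)] at hA
  exact hA.false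

theorem transpose (h : SameDescents A B) : SameDescents A.transpose B.transpose := by
  intro n S hS
  rw [descentCount_transpose A hS, descentCount_transpose B hS]
  exact h n _ Finset.sdiff_subset

/-- Some monomial with `x_0` to the power `A.numCols` occurs in `s_A`, through some descent set.
With fewer columns in `B` its coefficient in `s_B` would vanish, and with it every nonnegative
summand, including that of the same descent set. -/
theorem numCols_le (h : SameDescents A B) : A.numCols ≤ B.numCols := by
  by_contra! hlt
  obtain ⟨T⟩ := (inferInstance : Nonempty A.shrink.SSYT)
  have hA := coeff_skewSchur_pos T
  rw [← headCoeff_skewSchur, coeff_headCoeff, coeff_skewSchur_eq_sum] at hA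
  obtain ⟨S, hS, hne⟩ := Finset.exists_ne_zero_of_sum_ne_zero hA.ne'
  have hpos := Nat.pos_of_ne_zero (Nat.cast_ne_zero.1 hne)
  have hB := coeff_skewSchur_eq_zero_of_numCols_lt (A := B)
    (d := Finsupp.natCons A.numCols T.content) (by rwa [Finsupp.natCons_zero])
  rw [coeff_skewSchur_eq_sum, Finset.sum_eq_zero_iff_of_nonneg fun _ _ => Nat.cast_nonneg _] at hB
  have h1 := (h _ S ((Finset.mem_powerset.1 hS).trans (Finsupp.breaks_subset _))).1
    hpos
  have h2 := hB S hS
  rw [Nat.cast_eq_zero] at h2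
  omega

theorem shrink_imp (h : SameDescents A B) {n : ℕ} {S : Finset ℕ} (hS : S ⊆ Finset.Ioo 0 n)
    (hA : 0 < A.shrink.descentCount n S) : 0 < B.shrink.descentCount n S := by
  rw [← Nat.cast_pos (α := ℚ), descentCount_shrink _ hS] at hA ⊢
  rw [← h.numCols_le.antisymm h.symm.numCols_le]
  obtain ⟨Q, hQ, hne⟩ := Finset.exists_ne_zero_of_sum_ne_zero hA.ne'
  have hpos := Nat.pos_of_ne_zero (Nat.cast_ne_zero.1 hne)
  refine Finset.sum_pos' (fun _ _ => Nat.cast_nonneg _) ⟨Q, hQ, ?_⟩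
  rw [Nat.cast_pos]
  exact (h _ Q (Finset.mem_powerset.1 (Finset.mem_filter.1 hQ).1)).1 hpos

theorem shrink (h : SameDescents A B) : SameDescents A.shrink B.shrink :=
  fun _ _ hS => ⟨h.shrink_imp hS, h.symm.shrink_imp hS⟩

end SameDescents

theorem sameDescents_of_fundamentalSupport_eq {A B : SkewShape}
    (h : fundamentalSupport A = fundamentalSupport B) : SameDescents A B := by
  intro n S hS
  obtain ⟨α, rfl⟩ := Composition.exists_partialSums_eq hS
  rw [← mem_fundamentalSupport_iff (A := A) (α := ⟨n, α⟩), h, mem_fundamentalSupport_iff]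

end SkewShape

/-! ### Transposing Schur expansions, and the conclusion. -/

/-- This replaces the involution `ω`. A Schur expansion of `s_A` is equivalent to the same linear
relation between descent counts, and complementing descent sets on both sides transposes all shapes.
-/
theorem linearCombination_schur_transpose {A : SkewShape} {c : YoungDiagram →₀ ℚ}
    (hc : Finsupp.linearCombination ℚ schur c = skewSchur A) :
    Finsupp.linearCombination ℚ schur (c.mapDomain YoungDiagram.transpose) =
      skewSchur A.transpose := by
  ext d
  have key : ∀ S ⊆ Finset.Ioo 0 d.degree,
      ∑ ν ∈ c.support, c ν * ((SkewShape.straight ν).descentCount d.degree S : ℚ) =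
        (A.descentCount d.degree S : ℚ) := fun S hS => by
    refine Finset.eq_of_sum_powerset_eq (U := Finset.Ioo 0 d.degree)
      (f := fun S => ∑ ν ∈ c.support,
        c ν * ((SkewShape.straight ν).descentCount d.degree S : ℚ))
      (g := fun S => (A.descentCount d.degree S : ℚ)) (fun X hX => ?_) hS
    obtain ⟨e, he, rfl⟩ := Finsupp.exists_breaks_eq hX
    rw [← he, ← coeff_skewSchur_eq_sum, ← hc, Finsupp.linearCombination_apply, Finsupp.sum,
      map_sum, Finset.sum_comm]
    refine Finset.sum_congr rfl fun ν _ => ?_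
    rw [← Finset.mul_sum, map_smul, schur, coeff_skewSchur_eq_sum, smul_eq_mul]
  rw [Finsupp.linearCombination_mapDomain, Finsupp.linearCombination_apply, Finsupp.sum, map_sum,
    coeff_skewSchur_eq_sum]
  trans ∑ ν ∈ c.support, ∑ S ∈ d.breaks.powerset,
    c ν * ((SkewShape.straight ν).descentCount d.degree (Finset.Ioo 0 d.degree \ S) : ℚ)
  · refine Finset.sum_congr rfl fun ν _ => ?_
    rw [map_smul, Function.comp, schur, coeff_skewSchur_eq_sum, smul_eq_mul, Finset.mul_sum,
      ← SkewShape.straight_transpose]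
    refine Finset.sum_congr rfl fun S hS => ?_
    rw [SkewShape.descentCount_transpose _ ((Finset.mem_powerset.1 hS).trans d.breaks_subset)]
  · rw [Finset.sum_comm]
    refine Finset.sum_congr rfl fun S hS => ?_
    rw [key _ Finset.sdiff_subset,
      SkewShape.descentCount_transpose _ ((Finset.mem_powerset.1 hS).trans d.breaks_subset)]

theorem schurSupport_transpose (A : SkewShape) :
    schurSupport A.transpose = YoungDiagram.transpose '' schurSupport A := by
  classical
  obtain ⟨c, hc⟩ := exists_linearCombination_schur_eq_skewSchur A
  rw [schurSupport_eq (linearCombination_schur_transpose hc), schurSupport_eq hc,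
    Finsupp.mapDomain_support_of_injective fun _ _ h => YoungDiagram.transpose_eq_iff.1 h,
    Finset.coe_image]

theorem rects_eq_of_support_eq {A B : SkewShape}
    (h : skewSchur A = skewSchur B ∨ schurSupport A = schurSupport B ∨
      fundamentalSupport A = fundamentalSupport B) {k l : ℕ} (hk : 1 ≤ k) (hl : 1 ≤ l) :
    A.rects k l = B.rects k l := by
  have hF : fundamentalSupport A = fundamentalSupport B → A.rects k l = B.rects k l := fun h =>
    SkewShape.rects_eq_of_relation (R := SkewShape.SameDescents) (fun _ _ h => h.card_eq)
      (fun _ _ h => h.transpose) (fun _ _ h => h.shrink)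
      (SkewShape.sameDescents_of_fundamentalSupport_eq h) hk hl
  rcases h with h | h | h
  -- The `F`-support depends only on the series `s_A`.
  · exact hF (by simp only [fundamentalSupport, h])
  · exact SkewShape.rects_eq_of_relation (R := fun A B => schurSupport A = schurSupport B)
      (fun _ _ h => card_eq_of_schurSupport_eq h)
      (fun A B h => by rw [schurSupport_transpose, schurSupport_transpose, h])
      (fun _ _ h => schurSupport_shrink_eq_of_eq h) h hk hl
  · exact hF h

theorem corollary4p3 (A B : SkewShape)
    (h : skewSchur A = skewSchur B ∨ schurSupport A = schurSupport B ∨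
      fundamentalSupport A = fundamentalSupport B) :
    (∀ k : ℕ, 1 ≤ k → A.rowsk k = B.rowsk k) ∧
    (∀ l : ℕ, 1 ≤ l → A.colsk l = B.colsk l) ∧
    (∀ k l : ℕ, 1 ≤ k → 1 ≤ l → A.rects k l = B.rects k l) :=
  ⟨fun _ hk => SkewShape.rowsk_eq_of_rects_eq hk fun _ hl => rects_eq_of_support_eq h hk hl,
    fun _ hl => SkewShape.colsk_eq_of_rects_eq hl fun _ hk => rects_eq_of_support_eq h hk hl,
    fun _ _ hk hl => rects_eq_of_support_eq h hk hl⟩
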